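/- **Setting.** Let $N\in\mathbb N$ and let $s\in\mathbb C$ with $s\neq 0$, $s^2\neq 1$; put $q=s^{-2}$. Let $\mathcal P_N$ be the set of collections $\omega$ of up-right paths in $\mathbb Z_{\ge 0}\times\{1,\dots,N\}$, no two sharing a horizontal or vertical edge, with one path entering from the left at each $(0,j)$, $1\le j\le N$, none entering from below, and all paths leaving through the top; $\omega$ is identified with the set of edges it occupies. Let $\mathsf{Sign}^+_m$ be the set of integer sequences $\lambda_1\ge\dots\ge\lambda_m\ge 0$, and let $\lambda^k(\omega)\in\mathsf{Sign}_k^+$ be the decreasing list of the $x$-coordinates at which $\omega$ crosses the line $y=k+\frac12$. Write $\omega(i,j)=(i_1,j_1;i_2,j_2)$ for the numbers of arrows at the vertex $(i,j)$ that enter from the bottom and left and leave to the top and right. Set $$w_u(0,0;0,0)=1,\quad w_u(1,0;1,0)=\tfrac{1-s^{-1}u}{1-su},\quad w_u(1,0;0,1)=\tfrac{(1-s^2)u}{1-su},$$ $$w_u(0,1;1,0)=\tfrac{1-s^{-2}}{1-su},\quad w_u(0,1;0,1)=\tfrac{u-s}{1-su},\quad w_u(1,1;1,1)=\tfrac{u-s^{-1}}{1-su},$$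 and all other $w_u=0$. For $f:\mathsf{Sign}^+_N\to\mathbb R$ and $\mathbf z=(z_1,\dots,z_N)\in\mathbb C^N$ put $$\mathcal W^f(\omega;\mathbf z)=f(\lambda^N(\omega))\prod_{i=0}^\infty\prod_{j=1}^N w_{z_j}(\omega(i,j)),\qquad Z^f(\mathbf z)=\sum_{\omega\in\mathcal P_N}\mathcal W^f(\omega;\mathbf z).$$ **Assumptions.** $u_1,\dots,u_N$ are pairwise distinct complex numbers with $su_j\ne1$; $f$ is supported on signatures with distinct parts; for all $\mathbf z$ in some neighborhood of $\mathbf u=(u_1,\dots,u_N)$ the weights $\mathcal W^f(\omega;\mathbf z)$, $\omega\in\mathcal P_N$, are absolutely summable; $\mathcal W^f(\omega;\mathbf u)\ge 0$ for all $\omega\in\mathcal P_N$, and $Z^f(\mathbf u)>0$. Let $\mathbb P^f(\omega)=\mathcal W^f(\omega;\mathbf u)/Z^f(\mathbf u)$, a probability measure on $\mathcal P_N$. **Operators.** Let $$F_k(u_1,\dots,u_k)=\frac{(1-q)^k}{\prod_{i=1}^k(1-su_i)}\sum_{\sigma\in S_k}\ \prod_{1\le\alpha<\beta\le k}\frac{u_{\sigma(\alpha)}-qu_{\sigma(\beta)}}{u_{\sigma(\alpha)}-u_{\sigma(\beta)}}\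 \prod_{i=1}^k\Big(\frac{u_{\sigma(i)}-s}{1-su_{\sigma(i)}}\Big)^{k-i},$$ and on functions of $m$ variables let $$D^k_m=\sum_{I\subset\{1,\dots,m\},\,|I|=k}\ \prod_{i\in I,\,j\notin I}\frac{u_j-qu_i}{u_j-u_i}\ \prod_{j\notin I}\Big(\frac{u_j-s}{u_j-sq}\Big)^k\ \frac{F_k(u_I)}{F_k(s,\dots,s)}\ \prod_{i\in I}T_{u_i,s},$$ where $u_I=(u_i)_{i\in I}$ and $T_{u_i,s}$ substitutes $s$ for $u_i$ (so $D_m^k=0$ if $k>m$). The singularities of $F_k$ and of $D_m^kG$ at points with $u_i=u_j$, $i\ne j$, are understood to be removed by continuity. On functions of $N\ge m$ variables $D^k_m$ acts in the first $m$ of them. **Events.** For $m,r\ge0$ let $\mathsf{Sign}^*_{m,r}$ be the set of $\lambda\in\mathsf{Sign}_m^+$ with $\lambda_1>\dots>\lambda_m$ and $\lambda_m=0,\ \lambda_{m-1}=1,\dots,\lambda_{m-r+1}=r-1$ (empty if $r>m$). For $1\le m_1\le\dots\le m_k\le N$ let $$A(\mathbf m)=\{\omega\in\mathcal P_N:\ \lambda^{m_i}(\omega)\in\mathsf{Sign}^*_{m_i,i},\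 i=1,\dots,k\},\qquad \mathcal W^f(\mathbf m;\mathbf z)=\sum_{\omega\in A(\mathbf m)}\mathcal W^f(\omega;\mathbf z).$$ **Lemma.** Under these assumptions, $$\mathbb P^f(A(\mathbf m))=\frac{\mathcal W^f(\mathbf m;\mathbf u)}{Z^f(\mathbf u)}=\frac{(D^1_{m_1}D^2_{m_2}\cdots D^k_{m_k}Z^f)(\mathbf u)}{Z^f(\mathbf u)}.$$ -/

import Mathlib

open Filter Topology MeasureTheory
open scoped ComplexOrder

noncomputable section

namespace SixVertex

/-- Non-negative signatures `λ₁ ≥ λ₂ ≥ ⋯ ≥ λ_m ≥ 0` of length `m`.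
The part `λ_{i+1}` is the value at `i : Fin m`. -/
def Sign (m : ℕ) : Type := {l : Fin m → ℕ // Antitone l}

/-- The set of signatures of length `m` with pairwise distinct parts. -/
def SignStar (m : ℕ) : Set (Sign m) := {l | StrictAnti l.1}

/-- Strict signatures with `λ_m = 0, λ_{m-1} = 1, …, λ_{m-r+1} = r - 1`.
The parts `λ_m, …, λ_{m-r+1}` have to exist, so the set is empty for `r > m`. -/
def SignStarZero (m r : ℕ) : Set (Sign m) :=
  {l | l ∈ SignStar m ∧ ∀ j < r, ∃ i : Fin m, (i : ℕ) + 1 + j = m ∧ l.1 i = j}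

/-- Collections of up-right paths on `ℤ_{≥0} × {1, …, N}` sharing no horizontal or vertical edge,
given by the edges they occupy; one path enters from the left in every row, none enters from below,
and all leave through the top. Row `y + 1` of the strip is indexed by `y : Fin N`.
`vert x y` tells whether the vertical edge above row `y` (below row `y + 1`) in column `x` is
occupied, and `hor x y` whether the horizontal edge entering column `x` from the left in row
`y + 1` is occupied. -/
@[ext]
structure PathConfig (N : ℕ) where
  vert : ℕ → Fin (N + 1) → Bool
  hor : ℕ → Fin N → Bool
  /-- at each vertex as many arrows come in (from below, left) as go out (to the top, right) -/
  conserve : ∀ x y, (vert x y.castSucc).toNat + (hor x y).toNat =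
    (vert x y.succ).toNat + (hor (x + 1) y).toNat
  bottom : ∀ x, vert x 0 = false
  left : ∀ y, hor 0 y = true
  /-- no path runs off to infinity on the right -/
  right : ∀ y, ∃ X, ∀ x ≥ X, hor x y = false

namespace PathConfig

variable {N : ℕ}

/-- The set of columns in which `ω` crosses the horizontal line at height `k + 1/2`. -/
def level (ω : PathConfig N) (k : ℕ) (hk : k ≤ N) : Set ℕ :=
  {x | ω.vert x ⟨k, Nat.lt_succ_of_le hk⟩ = true}

theorem sum_vert (ω : PathConfig N) (y : Fin N) (X : ℕ) :
    (∑ x ∈ Finset.range X, (ω.vert x y.succ).toNat) + (ω.hor X y).toNat =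
      (∑ x ∈ Finset.range X, (ω.vert x y.castSucc).toNat) + 1 := by
  induction X with
  | zero => simp [ω.left y]
  | succ X ih =>
    rw [Finset.sum_range_succ, Finset.sum_range_succ]
    have := ω.conserve X y
    omega

theorem exists_bound (ω : PathConfig N) (k : ℕ) (hk : k ≤ N) :
    ∃ X, (∀ x ≥ X, ω.vert x ⟨k, Nat.lt_succ_of_le hk⟩ = false) ∧
      ∑ x ∈ Finset.range X, (ω.vert x ⟨k, Nat.lt_succ_of_le hk⟩).toNat = k := by
  induction k with
  | zero => exact ⟨0, fun x _ => ω.bottom x, by simp⟩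
  | succ k ih =>
    obtain ⟨X, hX, hs⟩ := ih (by omega)
    have key : ∀ y : Fin N, y = ⟨k, hk⟩ → y.castSucc = ⟨k, by omega⟩ ∧
        y.succ = ⟨k + 1, by omega⟩ := by
      rintro _ rfl
      exact ⟨rfl, rfl⟩
    obtain ⟨h1, h2⟩ := key _ rfl
    obtain ⟨X', hX'⟩ := ω.right ⟨k, hk⟩
    refine ⟨max X X', fun x hx => ?_, ?_⟩
    · have hc := ω.conserve x ⟨k, hk⟩
      rw [h1, h2, hX x (le_trans (le_max_left _ _) hx),
        hX' x (le_trans (le_max_right _ _) hx)] at hc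
      have : (ω.vert x ⟨k + 1, by omega⟩).toNat = 0 := by
        simp only [Bool.toNat_false] at hc
        omega
      simpa using this
    · have hc := ω.sum_vert ⟨k, hk⟩ (max X X')
      rw [h1, h2, hX' _ (le_max_right _ _)] at hc
      have h3 : ∑ x ∈ Finset.range (max X X'), (ω.vert x ⟨k, by omega⟩).toNat = k := by
        refine Eq.trans ?_ hs
        symm
        apply Finset.sum_subset
        · intro x hx
          simp only [Finset.mem_range] at hx ⊢
          exact lt_of_lt_of_le hx (le_max_left _ _)
        · intro x _ hx
          simp only [Finset.mem_range, not_lt] at hx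
          rw [hX x hx]
          rfl
      rw [h3] at hc
      simpa using hc

theorem level_finite (ω : PathConfig N) (k : ℕ) (hk : k ≤ N) : (ω.level k hk).Finite := by
  obtain ⟨X, hX, -⟩ := ω.exists_bound k hk
  refine (Set.finite_Iio X).subset fun x hx => ?_
  by_contra h
  have h1 := hX x (not_lt.mp h)
  have h2 : ω.vert x ⟨k, Nat.lt_succ_of_le hk⟩ = true := hx
  rw [h1] at h2
  exact Bool.false_ne_true h2

theorem card_level (ω : PathConfig N) (k : ℕ) (hk : k ≤ N) :
    (ω.level_finite k hk).toFinset.card = k := by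
  obtain ⟨X, hX, hs⟩ := ω.exists_bound k hk
  have h : (ω.level_finite k hk).toFinset =
      (Finset.range X).filter fun x => ω.vert x ⟨k, Nat.lt_succ_of_le hk⟩ = true := by
    ext x
    simp only [Set.Finite.mem_toFinset, Finset.mem_filter, Finset.mem_range, level,
      Set.mem_ofPred_eq, iff_and_self]
    intro hx
    by_contra h
    rw [hX x (not_lt.mp h)] at hx
    exact Bool.false_ne_true hx
  rw [h, Finset.card_filter]
  conv_rhs => rw [← hs]
  refine Finset.sum_congr rfl fun x _ => ?_
  cases ω.vert x ⟨k, Nat.lt_succ_of_le hk⟩ <;> simp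

/-- `λ^k(ω)`: the `x`-coordinates, in decreasing order, of the intersections of `ω` with the
horizontal line at height `k + 1/2`. -/
def sig (ω : PathConfig N) (k : ℕ) (hk : k ≤ N) : Sign k :=
  ⟨fun i => (ω.level_finite k hk).toFinset.orderEmbOfFin (ω.card_level k hk) i.rev,
    fun _ _ h => ((ω.level_finite k hk).toFinset.orderEmbOfFin (ω.card_level k hk)).monotone
      (Fin.rev_le_rev.mpr h)⟩

end PathConfig

/-- The weight `w_u(i₁, j₁; i₂, j₂)` of a vertex with `i₁`, `j₁` arrows coming in from the bottom
and from the left, and `i₂`, `j₂` arrows going out to the top and to the right. -/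
def vertexWeight (s u : ℂ) : (i₁ j₁ i₂ j₂ : Bool) → ℂ
  | false, false, false, false => 1
  | true, false, true, false => (1 - s⁻¹ * u) / (1 - s * u)
  | true, false, false, true => (1 - s ^ 2) * u / (1 - s * u)
  | false, true, true, false => (1 - (s ^ 2)⁻¹) / (1 - s * u)
  | false, true, false, true => (u - s) / (1 - s * u)
  | true, true, true, true => (u - s⁻¹) / (1 - s * u)
  | _, _, _, _ => 0

/-- The weight `𝒲^f(ω; z)`. All but finitely many factors equal `1`. -/
def pathWeight {N : ℕ} (s : ℂ) (f : Sign N → ℝ) (z : Fin N → ℂ) (ω : PathConfig N) : ℂ :=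
  (∏ᶠ x : ℕ, ∏ y : Fin N,
    vertexWeight s (z y) (ω.vert x y.castSucc) (ω.hor x y) (ω.vert x y.succ) (ω.hor (x + 1) y)) *
  (f (ω.sig N le_rfl) : ℂ)

/-- The partition function `Z^f(z)`. -/
def partitionFn {N : ℕ} (s : ℂ) (f : Sign N → ℝ) (z : Fin N → ℂ) : ℂ :=
  ∑' ω : PathConfig N, pathWeight s f z ω

instance (N : ℕ) : MeasurableSpace (PathConfig N) := ⊤

/-- The six-vertex measure: it gives mass `𝒲^f(ω; u) / Z^f(u)` to the configuration `ω`
(the quotient is a non-negative real number whenever the measure is considered). -/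
def sixVertexMeasure {N : ℕ} (s : ℂ) (f : Sign N → ℝ) (u : Fin N → ℂ) : Measure (PathConfig N) :=
  Measure.sum fun ω => ENNReal.ofReal (pathWeight s f u ω / partitionFn s f u).re • Measure.dirac ω

/-- The event `A(m₁, …, m_k)` that `λ^{m_i}(ω)` lies in `Sign*_{m_i, i}` for `i = 1, …, k`.
The number `m_{i+1}` is the value of `m` at `i : Fin k`. -/
def eventA {N k : ℕ} (m : Fin k → ℕ) (hm : ∀ i, m i ≤ N) : Set (PathConfig N) :=
  {ω | ∀ i : Fin k, ω.sig (m i) (hm i) ∈ SignStarZero (m i) (i + 1)}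

/-- `𝒲^f(m; z)`, the total weight of the event `A(m)`. -/
def eventWeight {N k : ℕ} (s : ℂ) (f : Sign N → ℝ) (m : Fin k → ℕ) (hm : ∀ i, m i ≤ N)
    (z : Fin N → ℂ) : ℂ :=
  ∑' ω : eventA m hm, pathWeight s f z ω.1

/-- A function of `n` complex variables, given by an expression with removable singularities on the
hyperplanes `z_i = z_j`, extended by continuity: it is unchanged where the variables are pairwise
distinct, and elsewhere it is the limit along points with pairwise distinct coordinates. -/
def extendDiag {n : ℕ} (g : (Fin n → ℂ) → ℂ) (z : Fin n → ℂ) : ℂ :=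
  open Classical in
  if Function.Injective z then g z
  else limUnder (𝓝[{w : Fin n → ℂ | Function.Injective w}] z) g

/-- The symmetric rational function `F_k(u₁, …, u_k)`, with `q = s⁻²`. -/
def symF (s : ℂ) (k : ℕ) : (Fin k → ℂ) → ℂ :=
  extendDiag fun u =>
    let q : ℂ := (s ^ 2)⁻¹
    (1 - q) ^ k / (∏ i, (1 - s * u i)) *
      ∑ σ : Equiv.Perm (Fin k),
        (∏ α : Fin k, ∏ β ∈ Finset.Ioi α, (u (σ α) - q * u (σ β)) / (u (σ α) - u (σ β))) *
        ∏ i : Fin k, ((u (σ i) - s) / (1 - s * u (σ i))) ^ (k - 1 - (i : ℕ))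

/-- The operator `D_m^k` on functions of `m` variables, with `q = s⁻²`. Its coefficients have poles
on the hyperplanes `u_i = u_j`, where the value is defined by continuity. The substitution
`∏_{i ∈ I} T_{u_i, s}` replaces `u_i` by `s` for all `i ∈ I`. -/
def opD (s : ℂ) (m k : ℕ) (G : (Fin m → ℂ) → ℂ) : (Fin m → ℂ) → ℂ :=
  extendDiag fun u =>
    let q : ℂ := (s ^ 2)⁻¹
    ∑ I ∈ Finset.powersetCard k (Finset.univ : Finset (Fin m)),
      (∏ i ∈ I, ∏ j ∈ Iᶜ, (u j - q * u i) / (u j - u i)) *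
      (∏ j ∈ Iᶜ, ((u j - s) / (u j - s * q)) ^ k) *
      (symF s I.card (fun a => u (I.orderEmbOfFin rfl a)) / symF s k (fun _ => s)) *
      G (fun i => if i ∈ I then s else u i)

/-- `D_m^k` acting on a function of `N` variables through the first `m` of them. -/
def opDFirst (s : ℂ) {N : ℕ} (m k : ℕ) (hm : m ≤ N) (G : (Fin N → ℂ) → ℂ) (z : Fin N → ℂ) : ℂ :=
  opD s m k (fun w => G fun j => if h : (j : ℕ) < m then w ⟨j, h⟩ else z j)
    (fun i => z (Fin.castLE hm i))

/-- `D_{m₁}^1 D_{m₂}^2 ⋯ D_{m_k}^k G`; the operator `D_{m_k}^k` acts first. -/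
def opDProd (s : ℂ) {N k : ℕ} (m : Fin k → ℕ) (hm : ∀ i, m i ≤ N) (G : (Fin N → ℂ) → ℂ) :
    (Fin N → ℂ) → ℂ :=
  Fin.foldr k (fun i H => opDFirst s (m i) (i + 1) (hm i) H) G

end SixVertex

end

noncomputable section

namespace SixVertex

/-! The event says that for every `i` the columns `0, …, i - 1` are occupied at level `m_i`
(`eventA_eq_constrained`). So it suffices that `D_m^r` inserts the constraint "the first `r` columns
are occupied at level `m`" into a partition function whose existing constraints all lie at levels `≥
m` (`opDFirst_eq_constrSum`). The operator with the largest level acts first, so monotonicity of `m`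
makes this applicable at each step.

For the algebra, fix the occupation numbers `t` at level `m`. The partition function of the rows
below is a coordinate Bethe ansatz sum `bethe`, built column by column: an empty column multiplies
by the Möbius factor of each remaining variable, an occupied column absorbs one variable
(`bethe_transfer`, `rows_eq_bethe`). Hence it is symmetric in the row parameters. If `t` begins with
`r` occupied columns, splitting according to the set `I` of variables absorbed there gives a sum
over `|I| = r` (`bethe_replicate_append`), and `F_r` is the Bethe function of `r` fully packed
columns (`symF_formula`). On the other hand, a row with parameter `s` has only forced moves: it
fills column `0` and shifts everything below one column to the right (`rowAct_self`). Substituting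
`s` for the variables in `I` therefore strips `r` occupied columns at the cost of an explicit
constant, and gives zero if `t` does not begin with `r` occupied columns. Multiplied by the
coefficients of `D_m^r`, this is exactly the sum over `I`, so the Bethe functions are eigenfunctions
with eigenvalue `1` or `0` (`sum_coeffD_mul_betheExt`). The relation is linear in the state at level
`m`, so it propagates through the rows above (`sum_mul_resRows`).

For the analysis, the points with some coordinates equal to `s` need not be near `u`, where
summability is assumed. But `mob s s = 0`, and the only nontrivial weight that can occur arbitrarily
often in a configuration is the horizontal move, whose weight is `mob`. Thus summability at one
point `z'` near `u` with larger Möbius moduli dominates the series throughout `mobDisc`, an open set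
that contains `u` and is stable under substituting `s` (`exists_norm_pathWeight_le`,
`exists_dominating`). Domination also gives the continuity needed to remove the singularities at
coinciding variables. -/

/-- The Möbius map `u ↦ (u - s) / (1 - s u)`. -/
def mob (s u : ℂ) : ℂ := (u - s) / (1 - s * u)

/-- The scattering factor `(v - q u) / (v - u)`. -/
def scat (s u v : ℂ) : ℂ := (v - (s ^ 2)⁻¹ * u) / (v - u)

/-- The exchange factor `(1 - q) u / (u - v)`. -/
def exch (s u v : ℂ) : ℂ := (1 - (s ^ 2)⁻¹) * u / (u - v)

/-- The weight of the emission `(0, 1; 1, 0)`. -/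
def emit (s u : ℂ) : ℂ := (1 - (s ^ 2)⁻¹) / (1 - s * u)

/-! ### Rational identities between vertex weights and Bethe amplitudes. -/

section identities
variable {s u v w : ℂ}

theorem exch_mob (hs : s ≠ 0) (hu : 1 - s * u ≠ 0) (hv : 1 - s * v ≠ 0) (huv : u ≠ v) :
    mob s v * exch s u v + (1 - s ^ 2) * u / (1 - s * u) * emit s v = exch s u v * mob s u := by
  have h1 : u - v ≠ 0 := sub_ne_zero.2 huv
  simp only [mob, exch, emit]
  field_simp
  linear_combination (s * u + s ^ 2 * u ^ 2 - s ^ 3 * u - u ^ 2) * mul_inv_cancel₀ hv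

theorem emit_mob_exch (hs : s ≠ 0) (hu : 1 - s * u ≠ 0) (hv : 1 - s * v ≠ 0) (huv : u ≠ v) :
    emit s u * mob s v * exch s u v + (u - s⁻¹) / (1 - s * u) * emit s v =
      emit s v * mob s u * scat s v u := by
  have h1 : u - v ≠ 0 := sub_ne_zero.2 huv
  simp only [mob, exch, emit, scat]
  field_simp
  ring

theorem scat_add_exch (hs : s ≠ 0) (hu : 1 - s * u ≠ 0) (hv : 1 - s * v ≠ 0) (huv : u ≠ v) :
    (1 - s⁻¹ * u) / (1 - s * u) * emit s v = scat s u v * emit s v + exch s u v * emit s u := by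
  have h1 : u - v ≠ 0 := sub_ne_zero.2 huv
  have h2 : v - u ≠ 0 := sub_ne_zero.2 huv.symm
  have h3 : scat s u v = - ((v - (s ^ 2)⁻¹ * u) / (u - v)) := by
    rw [scat, ← neg_sub u v, div_neg]
  rw [h3]
  simp only [exch, emit]
  field_simp
  ring

/-- Both sides are symmetrised in `v` and `w`: two variables leave the set, one absorbed and one
exchanged with `u`, in either role. -/
theorem exch_pair (hs : s ≠ 0) (hu : 1 - s * u ≠ 0) (hv : 1 - s * v ≠ 0) (hw : 1 - s * w ≠ 0)
    (huv : u ≠ v) (huw : u ≠ w) (hvw : v ≠ w) :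
    (1 - s⁻¹ * u) / (1 - s * u) *
      (emit s w * mob s v * scat s w v * exch s u v + emit s v * mob s w * scat s v w * exch s u w) =
    mob s u * (exch s u w * scat s w v * emit s v * scat s v u +
      exch s u v * scat s v w * emit s w * scat s w u) := by
  have h1 : u - v ≠ 0 := sub_ne_zero.2 huv
  have h2 : u - w ≠ 0 := sub_ne_zero.2 huw
  have h3 : v - w ≠ 0 := sub_ne_zero.2 hvw
  have h4 : scat s v w = - ((w - (s ^ 2)⁻¹ * v) / (v - w)) := by
    rw [scat, ← neg_sub v w, div_neg]
  rw [h4]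
  simp only [mob, exch, emit, scat]
  field_simp
  ring

end identities

/-! ### The row transfer operator. -/

/-- The action of one row with spectral parameter `u` on a function `g` of the occupation numbers
below the row, evaluated at the occupation numbers `t` above it. Here `h` is the occupation of the
edge entering from the left, and the edge leaving to the right is empty. -/
def rowAct (s u : ℂ) : List Bool → Bool → (List Bool → ℂ) → ℂ
  | [], h, g => if h then 0 else g []
  | t₀ :: t, h, g => ∑ b₀ : Bool, ∑ h' : Bool,
      vertexWeight s u b₀ h t₀ h' * rowAct s u t h' fun b => g (b₀ :: b)

theorem rowAct_false_true (s u : ℂ) (t : List Bool) (g : List Bool → ℂ) :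
    rowAct s u (false :: t) true g = mob s u * rowAct s u t true fun b => g (false :: b) := by
  simp [rowAct, vertexWeight, mob]

theorem rowAct_true_true (s u : ℂ) (t : List Bool) (g : List Bool → ℂ) :
    rowAct s u (true :: t) true g = emit s u * (rowAct s u t false fun b => g (false :: b)) +
      (u - s⁻¹) / (1 - s * u) * rowAct s u t true fun b => g (true :: b) := by
  simp [rowAct, vertexWeight, emit]; ring

theorem rowAct_false_false (s u : ℂ) (t : List Bool) (g : List Bool → ℂ) :
    rowAct s u (false :: t) false g = (rowAct s u t false fun b => g (false :: b)) +
      (1 - s ^ 2) * u / (1 - s * u) * rowAct s u t true fun b => g (true :: b) := by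
  simp [rowAct, vertexWeight]; ring

theorem rowAct_true_false (s u : ℂ) (t : List Bool) (g : List Bool → ℂ) :
    rowAct s u (true :: t) false g =
      (1 - s⁻¹ * u) / (1 - s * u) * rowAct s u t false fun b => g (true :: b) := by
  simp [rowAct, vertexWeight]

theorem rowAct_zero (s u : ℂ) (t : List Bool) (h : Bool) : rowAct s u t h (fun _ => 0) = 0 := by
  induction t generalizing h with
  | nil => simp [rowAct]
  | cons t₀ t ih => simp [rowAct, ih]

theorem rowAct_add (s u : ℂ) (t : List Bool) (h : Bool) (g₁ g₂ : List Bool → ℂ) :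
    rowAct s u t h (fun b => g₁ b + g₂ b) = rowAct s u t h g₁ + rowAct s u t h g₂ := by
  induction t generalizing h g₁ g₂ with
  | nil => cases h <;> simp [rowAct]
  | cons t₀ t ih => simp only [rowAct, ih, mul_add, Finset.sum_add_distrib]

theorem rowAct_mul (s u : ℂ) (t : List Bool) (h : Bool) (c : ℂ) (g : List Bool → ℂ) :
    rowAct s u t h (fun b => c * g b) = c * rowAct s u t h g := by
  induction t generalizing h g with
  | nil => cases h <;> simp [rowAct]
  | cons t₀ t ih =>
    simp only [rowAct, ih, Finset.mul_sum]
    exact Finset.sum_congr rfl fun _ _ => Finset.sum_congr rfl fun _ _ => by ring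

theorem rowAct_sum {κ : Type*} (s u : ℂ) (t : List Bool) (h : Bool) (J : Finset κ) (c : κ → ℂ)
    (g : κ → List Bool → ℂ) :
    rowAct s u t h (fun b => ∑ j ∈ J, c j * g j b) = ∑ j ∈ J, c j * rowAct s u t h (g j) := by
  classical
  induction J using Finset.induction_on with
  | empty => simpa using rowAct_zero s u t h
  | insert j J hj ih => simp only [Finset.sum_insert hj, rowAct_add, rowAct_mul, ih]

/-! ### Bethe wave functions. -/

section bethe
variable {ι : Type*} [DecidableEq ι]

/-- The amplitude for the variable `z j` to be absorbed in a column, next to the variables in `S`. -/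
def absorb (s : ℂ) (z : ι → ℂ) (j : ι) (S : Finset ι) : ℂ :=
  emit s (z j) * ∏ l ∈ S, mob s (z l) * scat s (z j) (z l)

/-- The Bethe wave function at the occupation numbers `t` with the variables `z j`, `j ∈ S`. -/
def bethe (s : ℂ) (z : ι → ℂ) : List Bool → Finset ι → ℂ
  | [], S => if S = ∅ then 1 else 0
  | false :: t, S => (∏ l ∈ S, mob s (z l)) * bethe s z t S
  | true :: t, S => ∑ j ∈ S, absorb s z j (S.erase j) * bethe s z t (S.erase j)

theorem sum_erase_eq_of_symm {S : Finset ι} {X Y : ι → ι → ℂ}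
    (h : ∀ i ∈ S, ∀ j ∈ S, i ≠ j → X i j + X j i = Y i j + Y j i) :
    ∑ i ∈ S, ∑ j ∈ S.erase i, X i j = ∑ i ∈ S, ∑ j ∈ S.erase i, Y i j := by
  have key : ∀ X : ι → ι → ℂ, ∑ i ∈ S, ∑ j ∈ S.erase i, X i j =
      ∑ i ∈ S, ∑ j ∈ S.erase i, X j i := by
    intro X
    refine Finset.sum_comm' fun i j => ?_
    simp only [Finset.mem_erase, ne_comm (a := i)]
    tauto
  have h2 : ∑ i ∈ S, ∑ j ∈ S.erase i, (X i j + X j i) =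
      ∑ i ∈ S, ∑ j ∈ S.erase i, (Y i j + Y j i) :=
    Finset.sum_congr rfl fun i hi => Finset.sum_congr rfl fun j hj =>
      h i hi j (Finset.mem_of_mem_erase hj) (Finset.ne_of_mem_erase hj).symm
  simp only [Finset.sum_add_distrib] at h2
  rw [← key X, ← key Y, ← two_mul, ← two_mul] at h2
  exact mul_left_cancel₀ two_ne_zero h2

theorem absorb_insert (s : ℂ) (z : ι → ℂ) (j : ι) {l : ι} {S : Finset ι} (hl : l ∉ S) :
    absorb s z j (insert l S) = mob s (z l) * scat s (z j) (z l) * absorb s z j S := by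
  rw [absorb, absorb, Finset.prod_insert hl]; ring

/-- The induction over columns needs both boundary conditions at once, because the row changes state
whenever a path turns. With an empty left edge the answer has the usual Bethe ansatz shape: a wanted
term in which `p` scatters off all of `S`, and unwanted terms in which `p` replaces some `j`.
Comparing coefficients in each column gives the four rational identities above. -/
theorem bethe_transfer {s : ℂ} (hs : s ≠ 0) {z : ι → ℂ} (hz : Function.Injective z)
    (hp : ∀ j, 1 - s * z j ≠ 0) (p : ι) (t : List Bool) (S : Finset ι) (hpS : p ∉ S) :
    (rowAct s (z p) t true (fun b => bethe s z b S) = bethe s z t (insert p S)) ∧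
    (rowAct s (z p) t false (fun b => bethe s z b S) =
      (∏ l ∈ S, scat s (z p) (z l)) * bethe s z t S +
      ∑ j ∈ S, (exch s (z p) (z j) * ∏ l ∈ S.erase j, scat s (z j) (z l)) *
        bethe s z t (insert p (S.erase j))) := by
  induction t generalizing S with
  | nil =>
    constructor
    · simp [rowAct, bethe]
    · simp only [rowAct, bethe, Finset.insert_ne_empty]
      by_cases h : S = ∅ <;> simp [h]
  | cons t₀ t ih =>
    have ne : ∀ j ∈ S, p ≠ j := fun j hj h => hpS (h ▸ hj)
    have zne : ∀ j ∈ S, z p ≠ z j := fun j hj h => ne j hj (hz h)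
    have hpe : ∀ j, p ∉ S.erase j := fun j h => hpS (Finset.mem_of_mem_erase h)
    have ihT := fun S hS => (ih S hS).1
    have ihF := fun S hS => (ih S hS).2
    cases t₀ with
    | false =>
      refine ⟨?_, ?_⟩
      · simp only [rowAct_false_true, bethe, rowAct_mul, ihT S hpS, Finset.prod_insert hpS]
        ring
      · simp only [rowAct_false_false, bethe, rowAct_mul, rowAct_sum, ihF S hpS,
          fun j => ihT _ (hpe j)]
        rw [mul_add, Finset.mul_sum,
          Finset.mul_sum, add_assoc, ← Finset.sum_add_distrib]
        congr 1
        · ring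
        · refine Finset.sum_congr rfl fun j hj => ?_
          rw [Finset.prod_insert (hpe j), ← Finset.mul_prod_erase S _ hj, absorb,
            Finset.prod_mul_distrib]
          linear_combination ((∏ l ∈ S.erase j, mob s (z l)) *
            (∏ l ∈ S.erase j, scat s (z j) (z l)) * bethe s z t (insert p (S.erase j))) *
            exch_mob hs (hp p) (hp j) (zne j hj)
    | true =>
      refine ⟨?_, ?_⟩
      · simp only [rowAct_true_true, bethe, rowAct_mul, rowAct_sum, ihF S hpS,
          fun j => ihT _ (hpe j)]
        rw [Finset.sum_insert hpS,
          Finset.erase_insert hpS, mul_add, mul_add, Finset.mul_sum, Finset.mul_sum, Finset.mul_sum,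
          add_assoc, ← Finset.sum_add_distrib]
        congr 1
        · rw [absorb, Finset.prod_mul_distrib]; ring
        · refine Finset.sum_congr rfl fun j hj => ?_
          rw [Finset.erase_insert_of_ne (ne j hj), absorb_insert s z j (hpe j),
            ← Finset.mul_prod_erase S _ hj, absorb, Finset.prod_mul_distrib]
          linear_combination ((∏ l ∈ S.erase j, mob s (z l)) *
            (∏ l ∈ S.erase j, scat s (z j) (z l)) * bethe s z t (insert p (S.erase j))) *
            emit_mob_exch hs (hp p) (hp j) (zne j hj)
      · simp only [rowAct_true_false, bethe, rowAct_sum, fun j => ihF _ (hpe j)]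
        -- After `p` has replaced `j`, the variable absorbed in this column is either `p` itself,
        -- which restores `S.erase j`, or some other `i`. The former joins the wanted term, the
        -- latter leaves a double sum.
        have h2 : ∀ j ∈ S, ∑ i ∈ insert p (S.erase j), absorb s z i ((insert p (S.erase j)).erase i) *
            bethe s z t ((insert p (S.erase j)).erase i) =
            absorb s z p (S.erase j) * bethe s z t (S.erase j) +
            ∑ i ∈ S.erase j, absorb s z i (insert p ((S.erase j).erase i)) *
              bethe s z t (insert p ((S.erase j).erase i)) := by
          intro j hj
          rw [Finset.sum_insert (hpe j), Finset.erase_insert (hpe j)]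
          congr 1
          refine Finset.sum_congr rfl fun i hi => ?_
          rw [Finset.erase_insert_of_ne (ne i (Finset.mem_of_mem_erase hi))]
        have h3 : ∀ c : ι → ℂ, ∑ j ∈ S, c j * ∑ i ∈ insert p (S.erase j),
            absorb s z i ((insert p (S.erase j)).erase i) *
              bethe s z t ((insert p (S.erase j)).erase i) =
            ∑ j ∈ S, c j * (absorb s z p (S.erase j) * bethe s z t (S.erase j) +
            ∑ i ∈ S.erase j, absorb s z i (insert p ((S.erase j).erase i)) *
              bethe s z t (insert p ((S.erase j).erase i))) :=
          fun c => Finset.sum_congr rfl fun j hj => by rw [h2 j hj]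
        rw [h3]
        simp only [mul_add, Finset.sum_add_distrib, Finset.mul_sum]
        rw [← add_assoc]
        congr 1
        · rw [← Finset.sum_add_distrib]
          refine Finset.sum_congr rfl fun j hj => ?_
          rw [← Finset.mul_prod_erase S _ hj, absorb, absorb, Finset.prod_mul_distrib,
            Finset.prod_mul_distrib]
          linear_combination ((∏ l ∈ S.erase j, mob s (z l)) *
            (∏ l ∈ S.erase j, scat s (z j) (z l)) * (∏ l ∈ S.erase j, scat s (z p) (z l)) *
            bethe s z t (S.erase j)) * scat_add_exch hs (hp p) (hp j) (zne j hj)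
        · apply sum_erase_eq_of_symm
          intro i hi j hj hij
          have e1 : (S.erase i).erase j = (S.erase j).erase i := Finset.erase_right_comm
          have hj' : j ∈ S.erase i := Finset.mem_erase.2 ⟨hij.symm, hj⟩
          have hi' : i ∈ S.erase j := Finset.mem_erase.2 ⟨hij, hi⟩
          have hpe' : p ∉ (S.erase j).erase i := fun h => hpe j (Finset.mem_of_mem_erase h)
          rw [e1, absorb_insert s z _ hpe', absorb_insert s z _ hpe', absorb, absorb, absorb, absorb,
            ← Finset.mul_prod_erase _ _ hj', ← Finset.mul_prod_erase _ _ hi',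
            ← Finset.mul_prod_erase _ _ hj', ← Finset.mul_prod_erase _ _ hi', e1]
          simp only [Finset.prod_mul_distrib]
          have zij : z i ≠ z j := fun h => hij (hz h)
          linear_combination ((∏ l ∈ (S.erase j).erase i, mob s (z l)) *
            (∏ l ∈ (S.erase j).erase i, scat s (z j) (z l)) *
            (∏ l ∈ (S.erase j).erase i, scat s (z i) (z l)) *
            bethe s z t (insert p ((S.erase j).erase i))) *
            exch_pair hs (hp p) (hp i) (hp j) (zne i hi) (zne j hj) zij

/-- Splitting off the variables that are absorbed in the first `r` columns, all occupied. -/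
theorem bethe_replicate_append (s : ℂ) (z : ι → ℂ) (r : ℕ) (t : List Bool) (S : Finset ι) :
    bethe s z (List.replicate r true ++ t) S = ∑ I ∈ S.powersetCard r,
      (∏ i ∈ I, ∏ j ∈ S \ I, scat s (z i) (z j)) * (∏ j ∈ S \ I, mob s (z j) ^ r) *
      bethe s z (List.replicate r true) I * bethe s z t (S \ I) := by
  induction r generalizing S with
  | zero => simp [bethe]
  | succ r ih =>
    simp only [List.replicate_succ, List.cons_append, bethe, ih, Finset.mul_sum, Finset.sum_mul]
    rw [Finset.sum_sigma', Finset.sum_sigma']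
    -- Choosing the variable `j` of the first column and then the set `I` for the next `r` columns
    -- amounts to choosing the set `insert j I` with a marked element.
    refine Finset.sum_bij' (fun x _ => ⟨insert x.1 x.2, x.1⟩) (fun x _ => ⟨x.2, x.1.erase x.2⟩)
      ?_ ?_ ?_ ?_ ?_
    · rintro ⟨j, I⟩ h
      simp only [Finset.mem_sigma, Finset.mem_powersetCard] at h ⊢
      obtain ⟨hj, hI, hc⟩ := h
      have hjI : j ∉ I := fun h => by simpa using hI h
      refine ⟨⟨?_, by rw [Finset.card_insert_of_notMem hjI, hc]⟩, Finset.mem_insert_self _ _⟩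
      exact Finset.insert_subset hj (hI.trans (Finset.erase_subset _ _))
    · rintro ⟨I, j⟩ h
      simp only [Finset.mem_sigma, Finset.mem_powersetCard] at h ⊢
      obtain ⟨⟨hI, hc⟩, hj⟩ := h
      exact ⟨hI hj, Finset.erase_subset_erase _ hI, by rw [Finset.card_erase_of_mem hj, hc]; rfl⟩
    · rintro ⟨j, I⟩ h
      simp only [Finset.mem_sigma, Finset.mem_powersetCard] at h
      obtain ⟨hj, hI, hc⟩ := h
      have hjI : j ∉ I := fun h => by simpa using hI h
      simp [hjI]
    · rintro ⟨I, j⟩ h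
      simp only [Finset.mem_sigma, Finset.mem_powersetCard] at h
      simp [Finset.insert_erase h.2]
    · rintro ⟨j, I⟩ h
      simp only [Finset.mem_sigma, Finset.mem_powersetCard] at h
      obtain ⟨hj, hI, hc⟩ := h
      have hjI : j ∉ I := fun h => by simpa using hI h
      have e1 : S.erase j \ I = S \ insert j I := by
        ext x; simp only [Finset.mem_sdiff, Finset.mem_erase, Finset.mem_insert]; tauto
      have e2 : absorb s z j (S.erase j) = absorb s z j I *
          ∏ l ∈ S \ insert j I, mob s (z l) * scat s (z j) (z l) := by
        rw [absorb, absorb, ← e1, mul_assoc, mul_comm (∏ l ∈ I, _), Finset.prod_sdiff hI]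
      simp only [e1, e2, Finset.erase_insert hjI, Finset.prod_insert hjI, Finset.prod_mul_distrib,
        pow_succ]
      ring

theorem bethe_append_false (s : ℂ) (z : ι → ℂ) (t : List Bool) (S : Finset ι) :
    bethe s z (t ++ [false]) S = bethe s z t S := by
  induction t generalizing S with
  | nil => by_cases h : S = ∅ <;> simp [bethe, h]
  | cons t₀ t ih => cases t₀ <;> simp [bethe, ih]

theorem bethe_eq_zero (s : ℂ) (z : ι → ℂ) (t : List Bool) (S : Finset ι)
    (h : t.count true ≠ S.card) : bethe s z t S = 0 := by
  induction t generalizing S with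
  | nil =>
    have : S ≠ ∅ := by rintro rfl; simp at h
    simp [bethe, this]
  | cons t₀ t ih =>
    cases t₀ with
    | false => rw [bethe, ih _ (by simpa using h), mul_zero]
    | true =>
      rw [bethe]
      refine Finset.sum_eq_zero fun j hj => ?_
      rw [ih, mul_zero]
      rw [Finset.card_erase_of_mem hj]
      have := Finset.card_pos.2 ⟨j, hj⟩
      simp only [List.count_cons_self] at h
      omega

theorem bethe_map {κ : Type*} [DecidableEq κ] (s : ℂ) (z : ι → ℂ) (e : κ ↪ ι) (t : List Bool)
    (S : Finset κ) : bethe s z t (S.map e) = bethe s (fun k => z (e k)) t S := by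
  induction t generalizing S with
  | nil => simp [bethe]
  | cons t₀ t ih =>
    cases t₀ with
    | false => simp [bethe, ih]
    | true =>
      simp only [bethe, Finset.sum_map]
      refine Finset.sum_congr rfl fun j _ => ?_
      rw [← Finset.map_erase, ih, absorb, absorb, Finset.prod_map]

end bethe

/-! ### Rows with spectral parameter `s`. -/

/-- At `u = s` a row shifts the occupation numbers by one column to the right. -/
theorem rowAct_self {s : ℂ} (hs : s ≠ 0) (hs₁ : s ^ 2 ≠ 1) (t : List Bool) (g : List Bool → ℂ) :
    rowAct s s (true :: t) true g =
      -(s ^ 2)⁻¹ * (-s⁻¹) ^ t.count true * g (t ++ [false]) ∧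
    rowAct s s (false :: t) false g = (-s⁻¹) ^ t.count true * g (t ++ [false]) := by
  have h1 : 1 - s * s ≠ 0 := by rw [← sq]; exact sub_ne_zero.2 hs₁.symm
  have e1 : emit s s = -(s ^ 2)⁻¹ := by rw [emit]; field_simp; ring
  have e2 : (s - s⁻¹) / (1 - s * s) = -s⁻¹ := by field_simp; ring
  have e3 : (1 - s ^ 2) * s / (1 - s * s) = s := by field_simp
  have e4 : (1 - s⁻¹ * s) / (1 - s * s) = 0 := by field_simp; simp
  have e5 : mob s s = 0 := by simp [mob]
  -- Since `e4` and `e5` kill both straight moves into an empty edge, an arrow entering alone from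
  -- below must turn right and one entering alone from the left must turn up. The top occupation of
  -- each column thus equals the occupation of its left edge.
  induction t generalizing g with
  | nil =>
    rw [rowAct_true_true, rowAct_false_false]
    simp [rowAct, e1]
  | cons t₀ t ih =>
    rw [rowAct_true_true, rowAct_false_false, e1, e2, e3]
    cases t₀ with
    | false => simp [rowAct_false_true, e5, (ih _).2, mul_assoc]
    | true =>
      rw [rowAct_true_false, e4, (ih _).1]
      constructor
      · simp [pow_succ]; ring
      · simp [pow_succ]; field_simp

theorem rowAct_self_false (s : ℂ) (t : List Bool) (g : List Bool → ℂ) :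
    rowAct s s (false :: t) true g = 0 := by
  simp [rowAct_false_true, mob]

/-! ### Stacks of rows and their extension to coinciding parameters. -/

/-- The partition function of finitely many rows, with the spectral parameters listed from top to
bottom, with every row entered from the left and with occupation numbers `t` at the top. -/
def rows (s : ℂ) : List ℂ → List Bool → ℂ
  | [], t => if true ∈ t then 0 else 1
  | u :: us, t => rowAct s u t true (rows s us)

/-- The points at which no vertex weight has a pole. -/
def regular (s : ℂ) (ι : Type*) : Set (ι → ℂ) := {z | ∀ j, 1 - s * z j ≠ 0}

theorem isOpen_regular (s : ℂ) (ι : Type*) [Finite ι] : IsOpen (regular s ι) := by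
  simp only [regular, Set.ofPred_forall]
  exact isOpen_iInter_of_finite fun j => isOpen_ne_fun (by fun_prop) (by fun_prop)

theorem bethe_empty {ι : Type*} [DecidableEq ι] (s : ℂ) (z : ι → ℂ) (t : List Bool) :
    bethe s z t ∅ = if true ∈ t then 0 else 1 := by
  induction t with
  | nil => simp [bethe]
  | cons t₀ t ih => cases t₀ <;> simp [bethe, ih]

/-- Iterating `bethe_transfer` from the vacuum. The right side depends only on the set of indices,
so the order of the rows is irrelevant. -/
theorem rows_eq_bethe {ι : Type*} [DecidableEq ι] {s : ℂ} (hs : s ≠ 0) {z : ι → ℂ}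
    (hz : Function.Injective z) (hp : z ∈ regular s ι) {l : List ι} (hl : l.Nodup) :
    rows s (l.map z) = fun t => bethe s z t l.toFinset := by
  induction l with
  | nil => funext t; simp [rows, bethe_empty]
  | cons j l ih =>
    rw [List.nodup_cons] at hl
    funext t
    rw [List.map_cons, rows, ih hl.2, List.toFinset_cons]
    exact (bethe_transfer hs hz hp j t l.toFinset (by simpa using hl.1)).1

theorem continuousOn_vertexWeight {X : Type*} [TopologicalSpace X] {P : Set X} (s : ℂ) {u : X → ℂ}
    (hu : ContinuousOn u P) (hp : ∀ x ∈ P, 1 - s * u x ≠ 0) (i₁ j₁ i₂ j₂ : Bool) :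
    ContinuousOn (fun x => vertexWeight s (u x) i₁ j₁ i₂ j₂) P := by
  cases i₁ <;> cases j₁ <;> cases i₂ <;> cases j₂ <;> simp only [vertexWeight] <;>
    first
    | exact continuousOn_const
    | exact ContinuousOn.div (by fun_prop) (by fun_prop) hp

theorem continuousOn_rowAct {X : Type*} [TopologicalSpace X] {P : Set X} (s : ℂ) {u : X → ℂ}
    (hu : ContinuousOn u P) (hp : ∀ x ∈ P, 1 - s * u x ≠ 0) (t : List Bool) (h : Bool)
    {g : X → List Bool → ℂ} (hg : ∀ b, ContinuousOn (fun x => g x b) P) :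
    ContinuousOn (fun x => rowAct s (u x) t h (g x)) P := by
  induction t generalizing h g with
  | nil => cases h <;> simp only [rowAct] <;> [exact hg []; exact continuousOn_const]
  | cons t₀ t ih =>
    simp only [rowAct]
    exact continuousOn_finsetSum _ fun b₀ _ => continuousOn_finsetSum _ fun h' _ =>
      (continuousOn_vertexWeight s hu hp _ _ _ _).mul (ih h' fun b => hg _)

theorem continuousOn_rows {ι : Type*} (s : ℂ) (l : List ι) (t : List Bool) :
    ContinuousOn (fun z : ι → ℂ => rows s (l.map z) t) (regular s ι) := by
  induction l generalizing t with
  | nil => exact continuousOn_const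
  | cons j l ih =>
    exact continuousOn_rowAct s (continuous_apply j).continuousOn (P := regular s ι)
      (fun z hz => hz j) t true ih

theorem neBot_injective {ι : Type*} [Finite ι] (z : ι → ℂ) :
    (𝓝[{w : ι → ℂ | Function.Injective w}] z).NeBot := by
  have := Fintype.ofFinite ι
  let e := Fintype.equivFin ι
  -- Perturbing along distinct integer slopes separates all coordinates for small nonzero `ε`.
  let γ : ℂ → ι → ℂ := fun ε i => z i + ε * (e i : ℕ)
  have hγ : Tendsto γ (𝓝[≠] 0) (𝓝 z) := by
    have : ContinuousAt γ 0 := by fun_prop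
    have h0 : γ 0 = z := by funext i; simp [γ]
    rw [ContinuousAt, h0] at this
    exact this.mono_left nhdsWithin_le_nhds
  have hinj : ∀ᶠ ε in 𝓝[≠] (0 : ℂ), Function.Injective (γ ε) := by
    have h1 : ∀ i j : ι, i ≠ j → ∀ᶠ ε in 𝓝[≠] (0 : ℂ), γ ε i ≠ γ ε j := by
      intro i j hij
      have hd : ((e i : ℕ) : ℂ) - (e j : ℕ) ≠ 0 := by
        rw [sub_ne_zero]
        exact fun h => hij (e.injective (Fin.ext (Nat.cast_injective h)))
      have hfin : ({-(z i - z j) / (((e i : ℕ) : ℂ) - (e j : ℕ))} : Set ℂ).Finite :=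
        Set.finite_singleton _
      by_cases h0 : z i = z j
      · filter_upwards [self_mem_nhdsWithin] with ε hε h
        simp only [γ, h0, add_right_inj] at h
        have : ε * (((e i : ℕ) : ℂ) - (e j : ℕ)) = 0 := by linear_combination h
        exact (mul_ne_zero hε hd) this
      · have : Tendsto (fun ε => γ ε i - γ ε j) (𝓝[≠] 0) (𝓝 (z i - z j)) :=
          ((tendsto_pi_nhds.1 hγ) i).sub ((tendsto_pi_nhds.1 hγ) j)
        filter_upwards [this.eventually_ne (sub_ne_zero.2 h0)] with ε h
        exact sub_ne_zero.1 h
    have h2 : ∀ᶠ ε in 𝓝[≠] (0 : ℂ), ∀ i j : ι, i ≠ j → γ ε i ≠ γ ε j := by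
      simp only [eventually_all]
      exact h1
    filter_upwards [h2] with ε h i j hij
    by_contra hne
    exact h i j hne hij
  have : Tendsto γ (𝓝[≠] 0) (𝓝[{w : ι → ℂ | Function.Injective w}] z) :=
    tendsto_nhdsWithin_iff.2 ⟨hγ, hinj⟩
  exact this.neBot

theorem extendDiag_eq {n : ℕ} {g f : (Fin n → ℂ) → ℂ} {z : Fin n → ℂ} (hf : ContinuousAt f z)
    (h : ∀ᶠ w in 𝓝[{w : Fin n → ℂ | Function.Injective w}] z, g w = f w) :
    extendDiag g z = f z := by
  rw [extendDiag]
  split_ifs with hz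
  · exact h.self_of_nhdsWithin hz
  · have := neBot_injective z
    exact ((hf.mono_left nhdsWithin_le_nhds).congr' (h.mono fun _ h => h.symm)).limUnder_eq

/-- Identities between continuous functions extend from points with distinct coordinates. -/
theorem eq_of_eq_injective {ι : Type*} [Finite ι] {s : ℂ} {f g : (ι → ℂ) → ℂ}
    (hf : ContinuousOn f (regular s ι)) (hg : ContinuousOn g (regular s ι))
    (h : ∀ z ∈ regular s ι, Function.Injective z → f z = g z) {z : ι → ℂ}
    (hz : z ∈ regular s ι) : f z = g z := by
  have := neBot_injective z
  have hn := (isOpen_regular s ι).mem_nhds hz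
  have h1 : Tendsto f (𝓝[{w : ι → ℂ | Function.Injective w}] z) (𝓝 (f z)) :=
    (hf.continuousAt hn).mono_left nhdsWithin_le_nhds
  have h2 : Tendsto g (𝓝[{w : ι → ℂ | Function.Injective w}] z) (𝓝 (g z)) :=
    (hg.continuousAt hn).mono_left nhdsWithin_le_nhds
  refine tendsto_nhds_unique_of_eventuallyEq h1 h2 ?_
  filter_upwards [mem_nhdsWithin_of_mem_nhds hn, self_mem_nhdsWithin] with w h3 h4
  exact h w h3 h4

/-- The extension of the Bethe wave function to points with coinciding coordinates. -/
def betheExt {ι : Type*} (s : ℂ) (t : List Bool) (S : Finset ι) (z : ι → ℂ) : ℂ := rows s (S.toList.map z) t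

theorem continuousOn_betheExt {ι : Type*} (s : ℂ) (t : List Bool) (S : Finset ι) :
    ContinuousOn (betheExt s t S) (regular s ι) := continuousOn_rows s _ t

section partFn
variable {ι : Type*} [DecidableEq ι]

theorem betheExt_of_injective {s : ℂ} (hs : s ≠ 0) (t : List Bool) (S : Finset ι) {z : ι → ℂ}
    (hp : z ∈ regular s ι) (hz : Function.Injective z) : betheExt s t S z = bethe s z t S := by
  rw [betheExt, rows_eq_bethe hs hz hp S.nodup_toList, Finset.toList_toFinset]

variable [Finite ι]

/-- Independence of the order of the rows survives at coinciding parameters by continuity. This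
allows any chosen row, in particular one with parameter `s`, to be moved to the top. -/
theorem rows_eq_betheExt {s : ℂ} (hs : s ≠ 0) (t : List Bool) {l : List ι} (hl : l.Nodup)
    {z : ι → ℂ} (hz : z ∈ regular s ι) : rows s (l.map z) t = betheExt s t l.toFinset z :=
  eq_of_eq_injective (continuousOn_rows s l t) (continuousOn_betheExt s t _)
    (fun z hp hz => by rw [betheExt_of_injective hs _ _ hp hz, rows_eq_bethe hs hz hp hl]) hz

theorem betheExt_insert {s : ℂ} (hs : s ≠ 0) (t : List Bool) {S : Finset ι} {j : ι} (hj : j ∉ S)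
    {z : ι → ℂ} (hz : z ∈ regular s ι) :
    betheExt s t (insert j S) z = rowAct s (z j) t true fun b => betheExt s b S z := by
  have := rows_eq_betheExt hs t (l := j :: S.toList) (by simp [hj, S.nodup_toList]) hz
  simpa [rows, betheExt] using this.symm

theorem betheExt_append_false {s : ℂ} (hs : s ≠ 0) (t : List Bool) (S : Finset ι)
    {z : ι → ℂ} (hz : z ∈ regular s ι) : betheExt s (t ++ [false]) S z = betheExt s t S z :=
  eq_of_eq_injective (continuousOn_betheExt s _ _) (continuousOn_betheExt s _ _)
    (fun z hp hz => by simp only [betheExt_of_injective hs _ _ hp hz, bethe_append_false]) hz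

theorem betheExt_eq_zero {s : ℂ} (hs : s ≠ 0) (t : List Bool) (S : Finset ι)
    {z : ι → ℂ} (hz : z ∈ regular s ι) (h : t.count true ≠ S.card) : betheExt s t S z = 0 :=
  eq_of_eq_injective (continuousOn_betheExt s _ _) continuousOn_const
    (fun z hp hz => by rw [betheExt_of_injective hs _ _ hp hz, bethe_eq_zero _ _ _ _ h]) hz

/-- The row with parameter `s` is moved to the top, where it only shifts. The exponent counts the
paths in `t`, and this is `S.card` unless both sides vanish. -/
theorem betheExt_insert_self {s : ℂ} (hs : s ≠ 0) (hs₁ : s ^ 2 ≠ 1) (t : List Bool) {S : Finset ι}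
    {j : ι} (hj : j ∉ S) {z : ι → ℂ} (hz : z ∈ regular s ι) (hzj : z j = s) :
    betheExt s (true :: t) (insert j S) z =
      -(s ^ 2)⁻¹ * (-s⁻¹) ^ S.card * betheExt s t S z := by
  rw [betheExt_insert hs _ hj hz, hzj, (rowAct_self hs hs₁ t _).1, betheExt_append_false hs t S hz]
  by_cases h : t.count true = S.card
  · rw [h]
  · rw [betheExt_eq_zero hs t S hz h, mul_zero, mul_zero]

theorem betheExt_union_self {s : ℂ} (hs : s ≠ 0) (hs₁ : s ^ 2 ≠ 1) {S I : Finset ι} {z : ι → ℂ}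
    (hz : z ∈ regular s ι) (hI : ∀ i ∈ I, z i = s) (hd : Disjoint I S) (t : List Bool) :
    betheExt s (List.replicate I.card true ++ t) (I ∪ S) z =
      (∏ p ∈ Finset.range I.card, -(s ^ 2)⁻¹ * (-s⁻¹) ^ (S.card + p)) * betheExt s t S z := by
  induction I using Finset.induction_on with
  | empty => simp
  | insert j I hj ih =>
    rw [Finset.disjoint_insert_left] at hd
    have hj' : j ∉ I ∪ S := by simp [hj, hd.1]
    rw [Finset.card_insert_of_notMem hj, Finset.insert_union, List.replicate_succ, List.cons_append,
      betheExt_insert_self hs hs₁ _ hj' hz (hI j (Finset.mem_insert_self _ _)),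
      ih (fun i hi => hI i (Finset.mem_insert_of_mem hi)) hd.2, Finset.prod_range_succ,
      Finset.card_union_of_disjoint hd.2, add_comm I.card]
    ring

/-- Each row with parameter `s` placed on top forces column `0` to be occupied, since its entering
path cannot move straight; peeling these rows off tests the prefix one entry at a time. -/
theorem betheExt_union_self_of_not_prefix {s : ℂ} (hs : s ≠ 0) (hs₁ : s ^ 2 ≠ 1) {S I : Finset ι}
    {z : ι → ℂ} (hz : z ∈ regular s ι) (hI : ∀ i ∈ I, z i = s) (hd : Disjoint I S) (t : List Bool)
    (ht : ¬ List.replicate I.card true <+: t) : betheExt s t (I ∪ S) z = 0 := by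
  induction I using Finset.induction_on generalizing t with
  | empty => simp at ht
  | insert j I hj ih =>
    rw [Finset.disjoint_insert_left] at hd
    have hj' : j ∉ I ∪ S := by simp [hj, hd.1]
    rw [Finset.card_insert_of_notMem hj, List.replicate_succ] at ht
    rw [Finset.insert_union]
    have hzj := hI j (Finset.mem_insert_self _ _)
    rcases t with _ | ⟨_ | _, t⟩
    · rw [betheExt_insert hs _ hj' hz]; simp [rowAct]
    · rw [betheExt_insert hs _ hj' hz, hzj, rowAct_self_false]
    · rw [betheExt_insert_self hs hs₁ t hj' hz hzj,
        ih (fun i hi => hI i (Finset.mem_insert_of_mem hi)) hd.2, mul_zero]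
      intro h
      exact ht (List.cons_prefix_cons.2 ⟨rfl, h⟩)

end partFn

/-! ### The function `F_k` and the eigenrelation for `D_m^k`. -/

/-- The permutation of `Fin (k + 1)` that sends the last element to `j` and acts as `τ` on the other
elements, up to the order-preserving bijections. -/
def permLast {k : ℕ} (j : Fin (k + 1)) (τ : Equiv.Perm (Fin k)) : Equiv.Perm (Fin (k + 1)) :=
  finSuccEquivLast.trans ((Equiv.optionCongr τ).trans (finSuccEquiv' j).symm)

theorem permLast_last {k : ℕ} (j : Fin (k + 1)) (τ : Equiv.Perm (Fin k)) :
    permLast j τ (Fin.last k) = j := by simp [permLast]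

theorem permLast_castSucc {k : ℕ} (j : Fin (k + 1)) (τ : Equiv.Perm (Fin k)) (i : Fin k) :
    permLast j τ i.castSucc = j.succAbove (τ i) := by simp [permLast]

theorem sum_perm_succ {k : ℕ} (f : Equiv.Perm (Fin (k + 1)) → ℂ) :
    ∑ σ, f σ = ∑ j, ∑ τ, f (permLast j τ) := by
  rw [← Fintype.sum_prod_type']
  symm
  refine Fintype.sum_bijective (fun x : Fin (k + 1) × Equiv.Perm (Fin k) => permLast x.1 x.2) ?_ _ _
    fun _ => rfl
  rw [Fintype.bijective_iff_injective_and_card]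
  constructor
  · rintro ⟨j, τ⟩ ⟨j', τ'⟩ h
    have h1 : j = j' := by
      simpa only [permLast_last] using congrArg (fun σ => σ (Fin.last k)) h
    subst h1
    have h2 : τ = τ' := by
      ext1 i
      have := congrArg (fun σ => σ i.castSucc) h
      simp only [permLast_castSucc] at this
      exact Fin.succAbove_right_injective this
    rw [h2]
  · simp [Fintype.card_perm, Nat.factorial_succ]

/-- In the permutation sum, the variable `u (σ i)` is the one absorbed in column `k - 1 - i`, having
crossed that many columns. The recursion for `bethe` on the first column is thus the expansion of
the sum over the value of `σ` at the last index. -/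
theorem symF_formula (s : ℂ) (k : ℕ) (u : Fin k → ℂ) :
    (1 - (s ^ 2)⁻¹) ^ k / (∏ i, (1 - s * u i)) *
      ∑ σ : Equiv.Perm (Fin k),
        (∏ α : Fin k, ∏ β ∈ Finset.Ioi α, (u (σ α) - (s ^ 2)⁻¹ * u (σ β)) / (u (σ α) - u (σ β))) *
        ∏ i : Fin k, ((u (σ i) - s) / (1 - s * u (σ i))) ^ (k - 1 - (i : ℕ)) =
    bethe s u (List.replicate k true) Finset.univ := by
  have e1 : ∀ k (u : Fin k → ℂ), (1 - (s ^ 2)⁻¹) ^ k / (∏ i, (1 - s * u i)) = ∏ i, emit s (u i) := by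
    intro k u
    simp [emit, Finset.prod_div_distrib]
  have e2 : ∀ k (u : Fin k → ℂ) (σ : Equiv.Perm (Fin k)),
      ∏ α : Fin k, ∏ β ∈ Finset.Ioi α, (u (σ α) - (s ^ 2)⁻¹ * u (σ β)) / (u (σ α) - u (σ β)) =
      ∏ α : Fin k, ∏ β, if α < β then scat s (u (σ β)) (u (σ α)) else 1 := by
    intro k u σ
    refine Finset.prod_congr rfl fun α _ => ?_
    rw [← Finset.prod_filter]
    refine Finset.prod_congr ?_ fun _ _ => rfl
    ext; simp
  rw [e1]
  simp only [e2]
  induction k with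
  | zero => simp [bethe]
  | succ k ih =>
    have hmap : ∀ j : Fin (k + 1), Finset.univ.erase j = Finset.univ.map j.succAboveEmb := by
      intro j
      ext x
      simp only [Finset.mem_erase, Finset.mem_univ, and_true, Finset.mem_map, true_and,
        Fin.succAboveEmb_apply, Fin.exists_succAbove_eq_iff]
    rw [sum_perm_succ, List.replicate_succ, bethe, Finset.mul_sum]
    refine Finset.sum_congr rfl fun j _ => ?_
    rw [absorb, hmap, bethe_map, Finset.prod_map]
    simp only [Fin.succAboveEmb_apply]
    rw [← ih, Finset.mul_sum, Finset.mul_sum, Finset.mul_sum, Fin.prod_univ_succAbove _ j]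
    refine Finset.sum_congr rfl fun τ _ => ?_
    rw [← Equiv.prod_comp τ fun x => mob s (u (j.succAbove x)) * scat s (u j) (u (j.succAbove x))]
    simp only [Fin.prod_univ_castSucc, permLast_last, permLast_castSucc, Fin.castSucc_lt_castSucc_iff,
      Fin.castSucc_lt_last, lt_irrefl, if_true, if_false, Finset.prod_mul_distrib]
    have h1 : ∀ x : Fin k, ¬ Fin.last k < x.castSucc := fun x => not_lt.2 (Fin.le_last _)
    -- Every variable except the one absorbed in the first column gains one Möbius factor from
    -- crossing that column.
    have h2 : ∀ x : Fin k, ((u (j.succAbove (τ x)) - s) / (1 - s * u (j.succAbove (τ x)))) ^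
        (k + 1 - 1 - (x.castSucc : ℕ)) = mob s (u (j.succAbove (τ x))) *
        ((u (j.succAbove (τ x)) - s) / (1 - s * u (j.succAbove (τ x)))) ^ (k - 1 - (x : ℕ)) := by
      intro x
      have : k + 1 - 1 - (x.castSucc : ℕ) = k - 1 - (x : ℕ) + 1 := by
        have := x.2
        simp only [Fin.val_castSucc]
        omega
      rw [this, pow_succ, mob, mul_comm]
    simp only [h1, h2, if_false, Finset.prod_const_one, Finset.prod_mul_distrib]
    simp
    ring

theorem symF_of_injective {s : ℂ} {k : ℕ} {u : Fin k → ℂ} (hu : Function.Injective u) :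
    symF s k u = bethe s u (List.replicate k true) Finset.univ := by
  rw [symF, extendDiag, if_pos hu, ← symF_formula]

theorem symF_eq_betheExt {s : ℂ} (hs : s ≠ 0) {k : ℕ} {u : Fin k → ℂ} (hu : u ∈ regular s (Fin k)) :
    symF s k u = betheExt s (List.replicate k true) Finset.univ u := by
  have hn := (isOpen_regular s (Fin k)).mem_nhds hu
  refine extendDiag_eq ((continuousOn_betheExt s _ _).continuousAt hn) ?_
  filter_upwards [mem_nhdsWithin_of_mem_nhds hn, self_mem_nhdsWithin] with w h1 h2
  rw [betheExt_of_injective hs _ _ h1 h2, ← symF_formula]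

theorem const_mem_regular {s : ℂ} (hs₁ : s ^ 2 ≠ 1) (ι : Type*) :
    (fun _ => s) ∈ regular s ι := fun _ => by
  rw [← sq]; exact sub_ne_zero.2 hs₁.symm

theorem symF_const {s : ℂ} (hs : s ≠ 0) (hs₁ : s ^ 2 ≠ 1) (k : ℕ) :
    symF s k (fun _ => s) = ∏ p ∈ Finset.range k, -(s ^ 2)⁻¹ * (-s⁻¹) ^ p := by
  rw [symF_eq_betheExt hs (const_mem_regular hs₁ _)]
  have := betheExt_union_self hs hs₁ (S := ∅) (I := (Finset.univ : Finset (Fin k)))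
    (const_mem_regular hs₁ _) (fun _ _ => rfl) (Finset.disjoint_empty_right _) []
  simpa [betheExt, rows] using this

/-- The coefficient of `∏ i ∈ I, T_{z_i, s}` in the operator `D_m^k`. -/
def coeffD (s : ℂ) {m : ℕ} (k : ℕ) (z : Fin m → ℂ) (I : Finset (Fin m)) : ℂ :=
  (∏ i ∈ I, ∏ j ∈ Iᶜ, (z j - (s ^ 2)⁻¹ * z i) / (z j - z i)) *
  (∏ j ∈ Iᶜ, ((z j - s) / (z j - s * (s ^ 2)⁻¹)) ^ k) *
  (symF s I.card (fun a => z (I.orderEmbOfFin rfl a)) / symF s k (fun _ => s))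

/-- Substitution of `s` for the variables with indices in `I`. -/
def substS {ι : Type*} [DecidableEq ι] (s : ℂ) (I : Finset ι) (z : ι → ℂ) : ι → ℂ :=
  fun i => if i ∈ I then s else z i

theorem opD_eq (s : ℂ) (m k : ℕ) (G : (Fin m → ℂ) → ℂ) :
    opD s m k G = extendDiag fun z => ∑ I ∈ Finset.powersetCard k Finset.univ,
      coeffD s k z I * G (substS s I z) := rfl

theorem substS_mem_regular {ι : Type*} [DecidableEq ι] {s : ℂ} (hs₁ : s ^ 2 ≠ 1) (I : Finset ι)
    {z : ι → ℂ} (hz : z ∈ regular s ι) : substS s I z ∈ regular s ι := by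
  intro j
  rw [substS]
  split_ifs
  · exact const_mem_regular hs₁ ι j
  · exact hz j

theorem symF_const_ne_zero {s : ℂ} (hs : s ≠ 0) (hs₁ : s ^ 2 ≠ 1) (k : ℕ) :
    symF s k (fun _ => s) ≠ 0 := by
  rw [symF_const hs hs₁]
  exact Finset.prod_ne_zero_iff.2 fun p _ => by simp [hs]

/-- Stripping the rows with parameter `s` yields `F_k(s, …, s)` times a power of `-s⁻¹`. The former
cancels the normalisation in the coefficient, the latter the powers of `-s` by which its
one-variable factors differ from `mob`. -/
theorem coeffD_mul_betheExt {s : ℂ} (hs : s ≠ 0) (hs₁ : s ^ 2 ≠ 1) {m k : ℕ} {z : Fin m → ℂ}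
    (hp : z ∈ regular s (Fin m)) (hz : Function.Injective z) {I : Finset (Fin m)} (hI : I.card = k)
    (t : List Bool) :
    coeffD s k z I * betheExt s (List.replicate k true ++ t) Finset.univ (substS s I z) =
      (∏ i ∈ I, ∏ j ∈ Iᶜ, scat s (z i) (z j)) * (∏ j ∈ Iᶜ, mob s (z j) ^ k) *
      bethe s z (List.replicate k true) I * bethe s z t Iᶜ := by
  subst hI
  have h1 : betheExt s (List.replicate I.card true ++ t) Finset.univ (substS s I z) =
      (∏ p ∈ Finset.range I.card, -(s ^ 2)⁻¹ * (-s⁻¹) ^ (Iᶜ.card + p)) *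
        betheExt s t Iᶜ (substS s I z) := by
    rw [← Finset.union_compl I]
    exact betheExt_union_self hs hs₁ (substS_mem_regular hs₁ I hp)
      (fun i hi => by simp [substS, hi]) disjoint_compl_right t
  have h2 : betheExt s t Iᶜ (substS s I z) = bethe s z t Iᶜ := by
    rw [← betheExt_of_injective hs _ _ hp hz, betheExt, betheExt]
    congr 1
    refine List.map_congr_left fun j hj => ?_
    rw [Finset.mem_toList, Finset.mem_compl] at hj
    simp [substS, hj]
  have h3 : symF s I.card (fun a => z (I.orderEmbOfFin rfl a)) =
      bethe s z (List.replicate I.card true) I := by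
    rw [symF_of_injective (u := fun a => z (I.orderEmbOfFin rfl a))
      (hz.comp (I.orderEmbOfFin rfl).injective)]
    refine (bethe_map s z (I.orderEmbOfFin rfl).toEmbedding _ _).symm.trans ?_
    congr 1
    exact Finset.map_orderEmbOfFin_univ I rfl
  -- The rows in `I` also shift the paths of `Iᶜ`; this contributes `-s⁻¹` for each pair in `I ×
  -- Iᶜ`.
  have h4 : ∏ p ∈ Finset.range I.card, -(s ^ 2)⁻¹ * (-s⁻¹) ^ (Iᶜ.card + p) =
      (-s⁻¹) ^ (Iᶜ.card * I.card) * symF s I.card (fun _ => s) := by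
    rw [symF_const hs hs₁, pow_mul, ← Finset.card_range I.card, ← Finset.prod_const,
      Finset.card_range, ← Finset.prod_mul_distrib]
    exact Finset.prod_congr rfl fun p _ => by rw [pow_add]; ring
  -- Since `q = s⁻²`, the denominator `z j - s q` equals `-(1 - s z j) / s`.
  have h5 : ∏ j ∈ Iᶜ, ((z j - s) / (z j - s * (s ^ 2)⁻¹)) ^ I.card =
      (-s) ^ (Iᶜ.card * I.card) * ∏ j ∈ Iᶜ, mob s (z j) ^ I.card := by
    rw [pow_mul, ← Finset.prod_const (s := Iᶜ), Finset.prod_pow, Finset.prod_pow, ← mul_pow,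
      ← Finset.prod_mul_distrib]
    congr 1
    refine Finset.prod_congr rfl fun j _ => ?_
    have h6 := hp j
    have h7 : z j - s * (s ^ 2)⁻¹ = -(1 - s * z j) / s := by field_simp; ring
    rw [h7, mob]
    field_simp
  have h6 : (-s) ^ (Iᶜ.card * I.card) * (-s⁻¹) ^ (Iᶜ.card * I.card) = 1 := by
    rw [← mul_pow, neg_mul_neg, mul_inv_cancel₀ hs, one_pow]
  have h7 := symF_const_ne_zero hs hs₁ I.card
  rw [coeffD, h1, h2, h3, h4, h5]
  simp only [scat]
  generalize ∏ i ∈ I, ∏ j ∈ Iᶜ, (z j - (s ^ 2)⁻¹ * z i) / (z j - z i) = a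
  linear_combination (a * (-s) ^ (Iᶜ.card * I.card) * (∏ j ∈ Iᶜ, mob s (z j) ^ I.card) *
    (-s⁻¹) ^ (Iᶜ.card * I.card) * bethe s z t Iᶜ) *
      div_mul_cancel₀ (bethe s z (List.replicate I.card true) I) h7 +
    (a * (∏ j ∈ Iᶜ, mob s (z j) ^ I.card) * bethe s z (List.replicate I.card true) I *
      bethe s z t Iᶜ) * h6

/-- The Bethe wave functions are eigenfunctions of `D_m^k`, with eigenvalue `1` if the first `k`
columns are occupied and `0` otherwise. -/
theorem sum_coeffD_mul_betheExt {s : ℂ} (hs : s ≠ 0) (hs₁ : s ^ 2 ≠ 1) {m : ℕ} (k : ℕ)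
    {z : Fin m → ℂ} (hp : z ∈ regular s (Fin m)) (hz : Function.Injective z) (t : List Bool) :
    ∑ I ∈ Finset.powersetCard k Finset.univ,
      coeffD s k z I * betheExt s t Finset.univ (substS s I z) =
    open Classical in
    if List.replicate k true <+: t then betheExt s t Finset.univ z else 0 := by
  split_ifs with h
  · obtain ⟨t, rfl⟩ := h
    rw [betheExt_of_injective hs _ _ hp hz, bethe_replicate_append]
    refine Finset.sum_congr rfl fun I hI => ?_
    rw [Finset.mem_powersetCard] at hI
    rw [coeffD_mul_betheExt hs hs₁ hp hz hI.2, Finset.compl_eq_univ_sdiff]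
  · refine Finset.sum_eq_zero fun I hI => ?_
    rw [Finset.mem_powersetCard] at hI
    rw [← Finset.union_compl I, betheExt_union_self_of_not_prefix hs hs₁
      (substS_mem_regular hs₁ I hp) (fun i hi => by simp [substS, hi]) disjoint_compl_right t
      (by rwa [hI.2]), mul_zero]

/-! ### Partition functions restricted at given levels. -/

open Classical in
/-- The partition function of the first `y` rows with occupation numbers `t` at the top, restricted
to the configurations with occupation numbers in `ok y` at every level `y`. -/
def resRows (s : ℂ) (ok : ℕ → List Bool → Prop) (z : ℕ → ℂ) : ℕ → List Bool → ℂ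
  | 0, t => if ok 0 t then rows s [] t else 0
  | y + 1, t => if ok (y + 1) t then rowAct s (z y) t true (resRows s ok z y) else 0

theorem resRows_eq_rows {s : ℂ} {ok : ℕ → List Bool → Prop} (z : ℕ → ℂ) {m : ℕ}
    (h : ∀ y < m, ∀ t, ok y t) (t : List Bool) :
    resRows s ok z m t =
      open Classical in if ok m t then rows s ((List.range m).reverse.map z) t else 0 := by
  induction m generalizing t with
  | zero => rfl
  | succ m ih =>
    rw [resRows, List.range_succ, List.reverse_append, List.reverse_singleton,
      List.singleton_append, List.map_cons, rows]
    congr 2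
    funext b
    rw [ih (fun y hy => h y (hy.trans (Nat.lt_succ_self m))), if_pos (h m (Nat.lt_succ_self m) b)]

theorem resRows_eq_betheExt {s : ℂ} (hs : s ≠ 0) {ok : ℕ → List Bool → Prop} {z : ℕ → ℂ} {m : ℕ}
    (h : ∀ y < m, ∀ t, ok y t) (hz : (fun i : Fin m => z i) ∈ regular s (Fin m)) (t : List Bool) :
    resRows s ok z m t = open Classical in
      if ok m t then betheExt s t Finset.univ (fun i : Fin m => z i) else 0 := by
  rw [resRows_eq_rows z h]
  congr 1
  have h1 := rows_eq_betheExt hs t (l := (List.finRange m).reverse)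
    (List.nodup_reverse.2 (List.nodup_finRange m)) hz
  have h2 : (List.finRange m).reverse.toFinset = Finset.univ := by ext; simp
  rw [h2] at h1
  rw [← h1, ← List.map_coe_finRange_eq_range, ← List.map_reverse, List.map_map]
  rfl

/-- Linear relations at level `m` persist at the levels above. -/
theorem sum_mul_resRows {κ : Type*} {s : ℂ} {ok ok' : ℕ → List Bool → Prop} (J : Finset κ)
    (c : κ → ℂ) (zs : κ → ℕ → ℂ) (z : ℕ → ℂ) {m : ℕ} (hz : ∀ i ∈ J, ∀ y ≥ m, zs i y = z y)
    (hok : ∀ y > m, ok y = ok' y)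
    (h : ∀ t, ∑ i ∈ J, c i * resRows s ok (zs i) m t = resRows s ok' z m t) {y : ℕ} (hy : m ≤ y)
    (t : List Bool) : ∑ i ∈ J, c i * resRows s ok (zs i) y t = resRows s ok' z y t := by
  induction y, hy using Nat.le_induction generalizing t with
  | base => exact h t
  | succ y hy ih =>
    have h1 : ok (y + 1) t = ok' (y + 1) t := by rw [hok (y + 1) (by omega)]
    by_cases h0 : ok' (y + 1) t
    · simp only [resRows, h1, h0, if_true]
      rw [← funext ih, rowAct_sum]
      exact Finset.sum_congr rfl fun i hi => by rw [hz i hi y hy]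
    · simp [resRows, h1, h0]

/-! ### From row operators to sums over path configurations. -/

theorem sum_fin_cons {κ : Type*} [Fintype κ] {n : ℕ} (f : (Fin (n + 1) → κ) → ℂ) :
    ∑ b, f b = ∑ b₀, ∑ b : Fin n → κ, f (Fin.cons b₀ b) := by
  rw [← (Fin.consEquiv fun _ => κ).sum_comp, Fintype.sum_prod_type]
  rfl

theorem sum_fin_snoc {κ : Type*} [Fintype κ] {n : ℕ} (f : (Fin (n + 1) → κ) → ℂ) :
    ∑ b, f b = ∑ b₀, ∑ b : Fin n → κ, f (Fin.snoc b b₀) := by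
  rw [← (Fin.snocEquiv fun _ => κ).sum_comp, Fintype.sum_prod_type]
  rfl

theorem rowAct_ofFn (s u : ℂ) {n : ℕ} (t : Fin n → Bool) (h : Bool) (g : List Bool → ℂ) :
    rowAct s u (List.ofFn t) h g = ∑ b : Fin n → Bool, ∑ H : Fin (n + 1) → Bool,
      if H 0 = h ∧ H (Fin.last n) = false then
        (∏ x, vertexWeight s u (b x) (H x.castSucc) (t x) (H x.succ)) * g (List.ofFn b) else 0 := by
  induction n generalizing h g with
  | zero =>
    rw [Fintype.sum_unique, sum_fin_cons]
    cases h <;> simp [rowAct]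
  | succ n ih =>
    rw [List.ofFn_succ, rowAct, sum_fin_cons]
    refine Finset.sum_congr rfl fun b₀ _ => ?_
    simp only [ih, Finset.mul_sum]
    rw [Finset.sum_comm]
    refine Finset.sum_congr rfl fun b _ => ?_
    rw [Finset.sum_comm]
    refine Eq.trans ?_ ((sum_fin_cons _).trans Finset.sum_comm).symm
    refine Finset.sum_congr rfl fun H _ => ?_
    -- The edge between the first two columns is recorded by `H 0`, and the leftmost edge is
    -- prescribed to be `h`.
    rw [Finset.sum_eq_single (H 0), Finset.sum_eq_single h]
    · simp only [Fin.cons_zero, true_and, ← Fin.succ_last, Fin.cons_succ,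
        Fin.prod_univ_succ, Fin.castSucc_zero, List.ofFn_succ, ← Fin.succ_castSucc]
      split_ifs
      · ring
      · simp
    · intro h' _ hh
      simp [hh]
    · simp
    · intro h' _ hh
      simp [Ne.symm hh]
    · simp

open Classical in
theorem resRows_ofFn (s : ℂ) (ok : ℕ → List Bool → Prop) (z : ℕ → ℂ) {n : ℕ} (N : ℕ)
    (t : Fin n → Bool) : resRows s ok z N (List.ofFn t) =
    ∑ V : Fin (N + 1) → Fin n → Bool, ∑ H : Fin N → Fin (n + 1) → Bool,
      if V (Fin.last N) = t ∧ (V 0 = fun _ => false) ∧ (∀ y : Fin (N + 1), ok y (List.ofFn (V y))) ∧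
        (∀ y, H y 0 = true ∧ H y (Fin.last n) = false) then
        ∏ y : Fin N, ∏ x : Fin n, vertexWeight s (z y) (V y.castSucc x) (H y x.castSucc)
          (V y.succ x) (H y x.succ) else 0 := by
  induction N generalizing t with
  | zero =>
    rw [sum_fin_snoc, resRows, Finset.sum_eq_single t]
    · have h1 : true ∈ List.ofFn t ↔ ¬ t = fun _ => false := by
        rw [List.mem_ofFn, funext_iff]
        simp
      by_cases h2 : ok 0 (List.ofFn t) <;> by_cases h3 : t = fun _ => false <;>
        simp [rows, h1, h2, h3, Fin.snoc]
    · intro t' _ h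
      simp [Fin.snoc, h]
    · simp
  | succ N ih =>
    rw [sum_fin_snoc, resRows, Finset.sum_eq_single t]
    · have hzero : ∀ V : Fin (N + 1) → Fin n → Bool,
          (Fin.snoc V t : Fin (N + 2) → Fin n → Bool) 0 = V 0 := fun V => by
        rw [← Fin.castSucc_zero, Fin.snoc_castSucc (α := fun _ => Fin n → Bool)]
      by_cases hok : ok (N + 1) (List.ofFn t)
      · rw [if_pos hok, rowAct_ofFn]
        simp only [ih, Finset.mul_sum]
        have h1 : ∀ (p : Prop) [Decidable p]
            (f : (Fin (N + 1) → Fin n → Bool) → (Fin N → Fin (n + 1) → Bool) → ℂ),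
            (if p then ∑ V, ∑ H, f V H else 0) = ∑ V, ∑ H, if p then f V H else 0 := by
          intro p _ f
          split_ifs <;> simp
        simp only [h1]
        rw [Finset.sum_congr rfl fun b _ => Finset.sum_comm, Finset.sum_comm]
        refine Finset.sum_congr rfl fun V _ => ?_
        rw [sum_fin_snoc, Finset.sum_eq_single (V (Fin.last N))]
        · refine Finset.sum_congr rfl fun η _ => Finset.sum_congr rfl fun H _ => ?_
          simp only [hzero, Fin.forall_fin_succ', Fin.snoc_castSucc (α := fun _ => Fin n → Bool),
            Fin.snoc_last (α := fun _ => Fin n → Bool), true_and,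
            Fin.snoc_castSucc (α := fun _ => Fin (n + 1) → Bool),
            Fin.snoc_last (α := fun _ => Fin (n + 1) → Bool), Fin.val_last, hok, and_true,
            Fin.prod_univ_castSucc, Fin.succ_castSucc, Fin.succ_last, Fin.val_castSucc]
          rw [mul_ite, mul_zero, ← ite_and, mul_comm]
          congr 1
          rw [eq_iff_iff]
          tauto
        · intro b _ hb
          refine Finset.sum_eq_zero fun η _ => Finset.sum_eq_zero fun H _ => ?_
          simp [Ne.symm hb]
        · simp
      · rw [if_neg hok]
        symm
        refine Finset.sum_eq_zero fun V _ => Finset.sum_eq_zero fun H _ => if_neg ?_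
        rintro ⟨-, -, h, -⟩
        have := h (Fin.last _)
        rw [Fin.snoc_last (α := fun _ => Fin n → Bool)] at this
        exact hok this
    · intro t' _ h
      refine Finset.sum_eq_zero fun V _ => Finset.sum_eq_zero fun H _ => if_neg ?_
      rintro ⟨h1, -⟩
      rw [Fin.snoc_last (α := fun _ => Fin n → Bool)] at h1
      exact h h1
    · simp

theorem toNat_eq_of_vertexWeight_ne_zero {s u : ℂ} {i₁ j₁ i₂ j₂ : Bool}
    (h : vertexWeight s u i₁ j₁ i₂ j₂ ≠ 0) : i₁.toNat + j₁.toNat = i₂.toNat + j₂.toNat := by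
  cases i₁ <;> cases j₁ <;> cases i₂ <;> cases j₂ <;> simp_all [vertexWeight]

namespace PathConfig
variable {N : ℕ}

/-- A path travelling horizontally beyond column `n` could never turn up, and would run off to
infinity. -/
theorem hor_eq_false (ω : PathConfig N) {y : Fin N} {n : ℕ}
    (h : ∀ x ≥ n, ω.vert x y.succ = false) : ∀ x ≥ n, ω.hor x y = false := by
  intro x hx
  by_contra hne
  have h1 : ∀ k, ω.hor (x + k) y = true := by
    intro k
    induction k with
    | zero => simpa using hne
    | succ k ih =>
      have hc := ω.conserve (x + k) y
      rw [ih, h (x + k) (by omega)] at hc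
      by_contra h0
      rw [Bool.not_eq_true] at h0
      rw [add_assoc] at hc
      rw [h0] at hc
      simp at hc
  obtain ⟨X, hX⟩ := ω.right y
  have := hX (x + X) (by omega)
  rw [h1 X] at this
  exact Bool.noConfusion this

theorem vert_eq_false (ω : PathConfig N) {n : ℕ} (h : ∀ x ≥ n, ω.vert x (Fin.last N) = false)
    (y : Fin (N + 1)) : ∀ x ≥ n, ω.vert x y = false := by
  induction y using Fin.reverseInduction with
  | last => exact h
  | cast y ih =>
    intro x hx
    have hc := ω.conserve x y
    rw [ih x hx, ω.hor_eq_false ih x hx, ω.hor_eq_false ih (x + 1) (by omega)] at hc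
    simpa using hc

/-- The product of the weights of the vertices of a configuration. -/
def weight (s : ℂ) (z : Fin N → ℂ) (ω : PathConfig N) : ℂ :=
  ∏ᶠ x : ℕ, ∏ y : Fin N,
    vertexWeight s (z y) (ω.vert x y.castSucc) (ω.hor x y) (ω.vert x y.succ) (ω.hor (x + 1) y)

theorem weight_eq_prod (s : ℂ) (z : Fin N → ℂ) (ω : PathConfig N) {n : ℕ}
    (h : ∀ x ≥ n, ω.vert x (Fin.last N) = false) :
    ω.weight s z = ∏ y : Fin N, ∏ x ∈ Finset.range n,
      vertexWeight s (z y) (ω.vert x y.castSucc) (ω.hor x y) (ω.vert x y.succ)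
        (ω.hor (x + 1) y) := by
  rw [weight, finprod_eq_prod_of_mulSupport_subset (s := Finset.range n), Finset.prod_comm]
  intro x hx
  by_contra hn
  simp only [Finset.coe_range, Set.mem_Iio, not_lt] at hn
  refine hx (Finset.prod_eq_one fun y _ => ?_)
  rw [ω.vert_eq_false h _ x hn, ω.vert_eq_false h _ x hn,
    ω.hor_eq_false (ω.vert_eq_false h _) x hn,
    ω.hor_eq_false (ω.vert_eq_false h _) (x + 1) (by omega)]
  rfl

/-- The sum over the configurations with given top level is computed row by row. -/
theorem tsum_top (s : ℂ) (ok : ℕ → List Bool → Prop) (z : ℕ → ℂ) {n : ℕ} (v : ℕ → Bool)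
    (hv : ∀ x ≥ n, v x = false) :
    ∑' ω : {ω : PathConfig N // (fun x => ω.vert x (Fin.last N)) = v}, (open Classical in
      if ∀ y : Fin (N + 1), ok y (List.ofFn fun x : Fin n => ω.1.vert x y) then
        ω.1.weight s (fun y => z y) else 0) =
    resRows s ok z N (List.ofFn fun x : Fin n => v x) := by
  classical
  let Ψ : (Fin (N + 1) → Fin n → Bool) × (Fin N → Fin (n + 1) → Bool) → ℂ := fun p =>
    if p.1 (Fin.last N) = (fun x : Fin n => v x) ∧ (p.1 0 = fun _ => false) ∧
        (∀ y : Fin (N + 1), ok y (List.ofFn (p.1 y))) ∧ (∀ y, p.2 y 0 = true ∧ p.2 y (Fin.last n) = false) then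
      ∏ y : Fin N, ∏ x : Fin n, vertexWeight s (z y) (p.1 y.castSucc x) (p.2 y x.castSucc)
        (p.1 y.succ x) (p.2 y x.succ) else 0
  let e : {ω : PathConfig N // (fun x => ω.vert x (Fin.last N)) = v} →
      (Fin (N + 1) → Fin n → Bool) × (Fin N → Fin (n + 1) → Bool) :=
    fun ω => (fun y x => ω.1.vert x y, fun y x => ω.1.hor x y)
  have htop : ∀ ω : {ω : PathConfig N // (fun x => ω.vert x (Fin.last N)) = v},
      ∀ x ≥ n, ω.1.vert x (Fin.last N) = false := fun ω x hx =>
    (congrFun ω.2 x).trans (hv x hx)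
  -- All edges to the right of the window of `n` columns are empty, so its edges determine the
  -- configuration.
  have he : Function.Injective e := by
    intro ω ω' h
    have h1 := congrArg Prod.fst h
    have h2 := congrArg Prod.snd h
    refine Subtype.ext (PathConfig.ext ?_ ?_)
    · funext x y
      by_cases hx : x < n
      · exact congrFun (congrFun h1 y) ⟨x, hx⟩
      · rw [ω.1.vert_eq_false (htop ω) y x (not_lt.1 hx),
          ω'.1.vert_eq_false (htop ω') y x (not_lt.1 hx)]
    · funext x y
      by_cases hx : x < n + 1
      · exact congrFun (congrFun h2 y) ⟨x, hx⟩
      · rw [ω.1.hor_eq_false (ω.1.vert_eq_false (htop ω) _) x (by omega),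
          ω'.1.hor_eq_false (ω'.1.vert_eq_false (htop ω') _) x (by omega)]
  -- A nonzero product of weights forces arrow conservation at each vertex of the window, so the
  -- pattern extends by empty edges to a configuration.
  have hΨ : Function.support Ψ ⊆ Set.range e := by
    rintro ⟨V, H⟩ hp
    have hp' : Ψ (V, H) ≠ 0 := hp
    simp only [Ψ] at hp'
    rw [ite_ne_right_iff] at hp'
    obtain ⟨⟨h1, h2, h3, h4⟩, h5⟩ := hp'
    simp only [Finset.prod_ne_zero_iff, Finset.mem_univ, forall_const] at h5
    refine ⟨⟨⟨fun x y => if h : x < n then V y ⟨x, h⟩ else false,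
      fun x y => if h : x < n + 1 then H y ⟨x, h⟩ else false, ?_, ?_, ?_, ?_⟩, ?_⟩, ?_⟩
    · intro x y
      rcases lt_trichotomy x n with hx | hx | hx
      · have := toNat_eq_of_vertexWeight_ne_zero (h5 y ⟨x, hx⟩)
        simpa [hx, hx.trans (Nat.lt_succ_self n)] using this
      -- At `x = n` the left edge is the right boundary of the window, empty by the condition on
      -- `H`.
      · have := (h4 y).2
        have h6 : Fin.last n = ⟨n, Nat.lt_succ_self n⟩ := rfl
        rw [h6] at this
        subst hx
        simp [this]
      · have h7 : ¬ x < n := by omega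
        have h8 : ¬ x < n + 1 := by omega
        simp [h7, h8]
    · intro x
      simp [h2]
    · intro y
      simpa using (h4 y).1
    · intro y
      exact ⟨n + 1, fun x hx => dif_neg (by omega)⟩
    · funext x
      by_cases hx : x < n
      · simpa [hx] using congrFun h1 ⟨x, hx⟩
      · simp [hx, hv x (not_lt.1 hx)]
    · refine Prod.ext ?_ ?_ <;> funext y x <;> simp [e, x.2]
  have hsum := (he.tsum_eq hΨ).trans (tsum_fintype Ψ)
  rw [resRows_ofFn, ← Fintype.sum_prod_type']
  refine Eq.trans ?_ hsum
  refine tsum_congr fun ω => ?_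
  have hc : ((e ω).1 (Fin.last N) = (fun x : Fin n => v x) ∧ ((e ω).1 0 = fun _ => false) ∧
      (∀ y : Fin (N + 1), ok y (List.ofFn ((e ω).1 y))) ∧
      (∀ y, (e ω).2 y 0 = true ∧ (e ω).2 y (Fin.last n) = false)) ↔
      ∀ y : Fin (N + 1), ok y (List.ofFn fun x : Fin n => ω.1.vert x y) := by
    refine ⟨fun h => h.2.2.1, fun h => ⟨?_, ?_, h, fun y => ⟨?_, ?_⟩⟩⟩
    · funext x
      exact congrFun ω.2 x
    · funext x
      exact ω.1.bottom x
    · exact ω.1.left y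
    · exact ω.1.hor_eq_false (ω.1.vert_eq_false (htop ω) _) n le_rfl
  simp only [Ψ, hc]
  split_ifs
  · rw [ω.1.weight_eq_prod s _ (htop ω)]
    refine Finset.prod_congr rfl fun y _ => ?_
    rw [Finset.prod_range]
    rfl
  · rfl

end PathConfig

/-! ### Domination, convergence and continuity. -/

theorem vertexWeight_stay_eq {s : ℂ} (hs : s ≠ 0) (u : ℂ) :
    vertexWeight s u true false true false = -s⁻¹ * mob s u := by
  simp only [vertexWeight, mob]
  rw [← mul_div_assoc]
  congr 1
  field_simp
  ring

theorem vertexWeight_cross_eq {s u : ℂ} (hs : s ≠ 0) (hu : 1 - s * u ≠ 0) :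
    vertexWeight s u true true true true = -s⁻¹ := by
  simp only [vertexWeight]
  rw [div_eq_iff hu]
  field_simp
  ring

/-- A factor `C` is charged only for occupied vertical edges, whose number is bounded independently
of the configuration. The horizontal move touches none of them, so it must be compared without loss;
this is the role of `h₁`. -/
theorem norm_vertexWeight_le {s u u' : ℂ} (hs : s ≠ 0) (hu : 1 - s * u ≠ 0) (hu' : 1 - s * u' ≠ 0)
    {C : ℝ} (hC : 1 ≤ C) (h₁ : ‖mob s u‖ ≤ ‖mob s u'‖)
    (h₂ : ‖(1 - s ^ 2) * u / (1 - s * u)‖ ≤ C * ‖(1 - s ^ 2) * u' / (1 - s * u')‖)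
    (h₃ : ‖emit s u‖ ≤ C * ‖emit s u'‖) (i₁ j₁ i₂ j₂ : Bool) :
    ‖vertexWeight s u i₁ j₁ i₂ j₂‖ ≤
      ((if i₁ then C else 1) * if i₂ then C else 1) * ‖vertexWeight s u' i₁ j₁ i₂ j₂‖ := by
  have hC0 : 0 ≤ C := zero_le_one.trans hC
  have hCC : 1 ≤ C * C := one_le_mul_of_one_le_of_one_le hC hC
  rcases i₁ <;> rcases j₁ <;> rcases i₂ <;> rcases j₂ <;> try simp [vertexWeight]
  · simpa [mob] using h₁
  · simpa [emit] using h₃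
  · simpa using h₂
  · have h : ∀ w : ℂ, (1 - s⁻¹ * w) / (1 - s * w) = -s⁻¹ * mob s w := vertexWeight_stay_eq hs
    rw [← norm_div, ← norm_div, h, h, norm_mul, norm_mul]
    calc ‖-s⁻¹‖ * ‖mob s u‖ ≤ 1 * (‖-s⁻¹‖ * ‖mob s u'‖) := by
          rw [one_mul]; gcongr
      _ ≤ _ := by gcongr
  · have h : ∀ w : ℂ, 1 - s * w ≠ 0 → (w - s⁻¹) / (1 - s * w) = -s⁻¹ :=
      fun w hw => vertexWeight_cross_eq hs hw
    rw [← norm_div, ← norm_div, h u hu, h u' hu']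
    exact le_mul_of_one_le_left (norm_nonneg _) hCC

namespace PathConfig
variable {N : ℕ}

theorem card_filter_vert_le (ω : PathConfig N) (y : Fin (N + 1)) (X : Finset ℕ) :
    (X.filter fun x => ω.vert x y = true).card ≤ N := by
  have hy : (y : ℕ) ≤ N := Nat.le_of_lt_succ y.2
  refine le_trans ?_ ((ω.card_level y hy).trans_le hy)
  refine Finset.card_le_card fun x hx => ?_
  rw [Set.Finite.mem_toFinset]
  exact (Finset.mem_filter.1 hx).2

/-- Each of the `N` rows has at most `N` occupied edges on either side, so the charges multiply to a
constant that does not depend on `ω`. -/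
theorem norm_weight_le {s : ℂ} (hs : s ≠ 0) {z z' : Fin N → ℂ} (hz : z ∈ regular s (Fin N))
    (hz' : z' ∈ regular s (Fin N)) {C : ℝ} (hC : 1 ≤ C) (h₁ : ∀ j, ‖mob s (z j)‖ ≤ ‖mob s (z' j)‖)
    (h₂ : ∀ j, ‖(1 - s ^ 2) * z j / (1 - s * z j)‖ ≤ C * ‖(1 - s ^ 2) * z' j / (1 - s * z' j)‖)
    (h₃ : ∀ j, ‖emit s (z j)‖ ≤ C * ‖emit s (z' j)‖) (ω : PathConfig N) :
    ‖ω.weight s z‖ ≤ (C ^ N * C ^ N) ^ N * ‖ω.weight s z'‖ := by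
  have hC0 : 0 ≤ C := zero_le_one.trans hC
  obtain ⟨n, hn, -⟩ := ω.exists_bound N le_rfl
  rw [ω.weight_eq_prod s z hn, ω.weight_eq_prod s z' hn, norm_prod, norm_prod]
  have hcard : ∀ y : Fin (N + 1),
      ∏ x ∈ Finset.range n, (if ω.vert x y then C else 1) ≤ C ^ N := fun y => by
    rw [Finset.prod_ite, Finset.prod_const, Finset.prod_const_one, mul_one]
    exact pow_le_pow_right₀ hC (ω.card_filter_vert_le y _)
  have hnn : ∀ b : Bool, 0 ≤ (if b then C else 1) := fun b => by split_ifs <;> positivity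
  have hrow : ∀ y : Fin N, ‖∏ x ∈ Finset.range n,
      vertexWeight s (z y) (ω.vert x y.castSucc) (ω.hor x y) (ω.vert x y.succ) (ω.hor (x + 1) y)‖ ≤
      (C ^ N * C ^ N) * ‖∏ x ∈ Finset.range n, vertexWeight s (z' y) (ω.vert x y.castSucc)
        (ω.hor x y) (ω.vert x y.succ) (ω.hor (x + 1) y)‖ := fun y => by
    rw [norm_prod, norm_prod]
    refine (Finset.prod_le_prod (fun _ _ => norm_nonneg _) fun x _ =>
      norm_vertexWeight_le hs (hz y) (hz' y) hC (h₁ y) (h₂ y) (h₃ y) _ _ _ _).trans ?_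
    rw [Finset.prod_mul_distrib, Finset.prod_mul_distrib]
    refine mul_le_mul_of_nonneg_right ?_ (Finset.prod_nonneg fun _ _ => norm_nonneg _)
    exact mul_le_mul (hcard _) (hcard _) (Finset.prod_nonneg fun _ _ => hnn _) (by positivity)
  refine (Finset.prod_le_prod (fun _ _ => norm_nonneg _) fun y _ => hrow y).trans ?_
  rw [Finset.prod_mul_distrib, Finset.prod_const, Finset.card_univ, Fintype.card_fin]

theorem continuousOn_weight (s : ℂ) (ω : PathConfig N) :
    ContinuousOn (fun z => ω.weight s z) (regular s (Fin N)) := by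
  obtain ⟨n, hn, -⟩ := ω.exists_bound N le_rfl
  have : (fun z => ω.weight s z) = _ := funext fun z => ω.weight_eq_prod s z hn
  rw [this]
  exact continuousOn_finsetProd _ fun y _ => continuousOn_finsetProd _ fun x _ =>
    continuousOn_vertexWeight s (continuous_apply y).continuousOn (P := regular s (Fin N))
      (fun z hz => hz y) _ _ _ _

end PathConfig

variable {N : ℕ}

theorem pathWeight_eq (s : ℂ) (f : Sign N → ℝ) (z : Fin N → ℂ) (ω : PathConfig N) :
    pathWeight s f z ω = ω.weight s z * (f (ω.sig N le_rfl) : ℂ) := rfl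

/-- The points whose coordinates have smaller Möbius images than those of `z'`. -/
def mobDisc (s : ℂ) (z' : Fin N → ℂ) : Set (Fin N → ℂ) :=
  {z | z ∈ regular s (Fin N) ∧ ∀ j, ‖mob s (z j)‖ < ‖mob s (z' j)‖}

theorem isOpen_mobDisc (s : ℂ) (z' : Fin N → ℂ) : IsOpen (mobDisc s z') := by
  rw [isOpen_iff_mem_nhds]
  rintro z ⟨hz, hlt⟩
  have h1 : ∀ j, ∀ᶠ w in 𝓝 z, ‖mob s (w j)‖ < ‖mob s (z' j)‖ := fun j => by
    have : ContinuousAt (fun w : Fin N → ℂ => ‖mob s (w j)‖) z :=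
      ContinuousAt.norm (ContinuousAt.div (Continuous.continuousAt (by fun_prop))
        (Continuous.continuousAt (by fun_prop)) (hz j))
    exact this.eventually_lt_const (hlt j)
  filter_upwards [(isOpen_regular s _).mem_nhds hz, eventually_all.2 h1] with w h2 h3
  exact ⟨h2, h3⟩

theorem exists_norm_pathWeight_le {s : ℂ} (hs : s ≠ 0) (hs₁ : s ^ 2 ≠ 1) (f : Sign N → ℝ)
    {z' : Fin N → ℂ} (hz' : z' ∈ regular s (Fin N)) (h0 : ∀ j, z' j ≠ 0) {z : Fin N → ℂ}
    (hz : z ∈ mobDisc s z') : ∃ C, ∀ᶠ w in 𝓝 z, ∀ ω,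
      ‖pathWeight s f w ω‖ ≤ C * ‖pathWeight s f z' ω‖ := by
  have hq : 1 - (s ^ 2)⁻¹ ≠ 0 := by
    rw [sub_ne_zero]
    intro h
    exact hs₁ (inv_eq_one.1 h.symm)
  have hA : ∀ j, 0 < ‖(1 - s ^ 2) * z' j / (1 - s * z' j)‖ := fun j =>
    norm_pos_iff.2 (div_ne_zero (mul_ne_zero (sub_ne_zero.2 hs₁.symm) (h0 j)) (hz' j))
  have hB : ∀ j, 0 < ‖emit s (z' j)‖ := fun j => norm_pos_iff.2 (div_ne_zero hq (hz' j))
  -- The ratios of the turning weights at `z` and `z'`; adding `1` to their sum leaves strict room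
  -- for a neighbourhood of `z`.
  let a : Fin N → ℝ := fun j => ‖(1 - s ^ 2) * z j / (1 - s * z j)‖ /
    ‖(1 - s ^ 2) * z' j / (1 - s * z' j)‖ + ‖emit s (z j)‖ / ‖emit s (z' j)‖
  have ha : ∀ j, 0 ≤ a j := fun j => by positivity
  have haC : ∀ j, a j < 1 + ∑ j, a j := fun j => by
    have := Finset.single_le_sum (fun i _ => ha i) (Finset.mem_univ j)
    linarith
  have e2 : ∀ j, ∀ᶠ w in 𝓝 z, ‖(1 - s ^ 2) * w j / (1 - s * w j)‖ <
      (1 + ∑ j, a j) * ‖(1 - s ^ 2) * z' j / (1 - s * z' j)‖ := fun j => by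
    have : ContinuousAt (fun w : Fin N → ℂ => ‖(1 - s ^ 2) * w j / (1 - s * w j)‖) z :=
      ContinuousAt.norm (ContinuousAt.div (Continuous.continuousAt (by fun_prop))
        (Continuous.continuousAt (by fun_prop)) (hz.1 j))
    refine this.eventually_lt_const ?_
    rw [← div_lt_iff₀ (hA j)]
    exact lt_of_le_of_lt (le_add_of_nonneg_right (by positivity)) (haC j)
  have e3 : ∀ j, ∀ᶠ w in 𝓝 z, ‖emit s (w j)‖ < (1 + ∑ j, a j) * ‖emit s (z' j)‖ := fun j => by
    have : ContinuousAt (fun w : Fin N → ℂ => ‖emit s (w j)‖) z :=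
      ContinuousAt.norm (ContinuousAt.div (Continuous.continuousAt (by fun_prop))
        (Continuous.continuousAt (by fun_prop)) (hz.1 j))
    refine this.eventually_lt_const ?_
    rw [← div_lt_iff₀ (hB j)]
    exact lt_of_le_of_lt (le_add_of_nonneg_left (by positivity)) (haC j)
  refine ⟨((1 + ∑ j, a j) ^ N * (1 + ∑ j, a j) ^ N) ^ N, ?_⟩
  filter_upwards [(isOpen_mobDisc s z').mem_nhds hz, eventually_all.2 e2, eventually_all.2 e3]
    with w h1 h2 h3 ω
  rw [pathWeight_eq, pathWeight_eq, norm_mul, norm_mul, ← mul_assoc]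
  refine mul_le_mul_of_nonneg_right ?_ (norm_nonneg _)
  exact ω.norm_weight_le hs h1.1 hz'
    (le_add_of_nonneg_right (Finset.sum_nonneg fun j _ => ha j))
    (fun j => (h1.2 j).le) (fun j => (h2 j).le) fun j => (h3 j).le

/-- The configurations whose first `r` columns are occupied at level `y`, for `(y, r) ∈ K`. -/
def constrained (N : ℕ) (K : Set (ℕ × ℕ)) : Set (PathConfig N) :=
  {ω | ∀ y : Fin (N + 1), ∀ r, ((y : ℕ), r) ∈ K → ∀ x < r, ω.vert x y = true}

/-- The partition function restricted to `constrained N K`. -/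
def constrSum (s : ℂ) (f : Sign N → ℝ) (K : Set (ℕ × ℕ)) (z : Fin N → ℂ) : ℂ :=
  ∑' ω : constrained N K, pathWeight s f z ω.1

section dominated
variable {s : ℂ} {f : Sign N → ℝ} {z' : Fin N → ℂ}

theorem summable_pathWeight (hs : s ≠ 0) (hs₁ : s ^ 2 ≠ 1) (hz' : z' ∈ regular s (Fin N))
    (h0 : ∀ j, z' j ≠ 0) (hsum : Summable fun ω => ‖pathWeight s f z' ω‖) {z : Fin N → ℂ}
    (hz : z ∈ mobDisc s z') : Summable fun ω => pathWeight s f z ω := by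
  obtain ⟨C, hC⟩ := exists_norm_pathWeight_le hs hs₁ f hz' h0 hz
  exact Summable.of_norm_bounded (hsum.mul_left C) hC.self_of_nhds

theorem continuousAt_constrSum (hs : s ≠ 0) (hs₁ : s ^ 2 ≠ 1) (hz' : z' ∈ regular s (Fin N))
    (h0 : ∀ j, z' j ≠ 0) (hsum : Summable fun ω => ‖pathWeight s f z' ω‖) (K : Set (ℕ × ℕ))
    {z : Fin N → ℂ} (hz : z ∈ mobDisc s z') : ContinuousAt (constrSum s f K) z := by
  obtain ⟨C, hC⟩ := exists_norm_pathWeight_le hs hs₁ f hz' h0 hz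
  obtain ⟨U, hU, hUo, hzU⟩ := eventually_nhds_iff.1
    (hC.and ((isOpen_regular s (Fin N)).mem_nhds hz.1))
  refine ContinuousOn.continuousAt (s := U) ?_ (hUo.mem_nhds hzU)
  refine continuousOn_tsum (u := fun ω : constrained N K => C * ‖pathWeight s f z' ω.1‖) ?_ ?_ ?_
  · intro ω
    exact ((ω.1.continuousOn_weight s).mono fun w hw => (hU w hw).2).mul continuousOn_const
  · exact (hsum.mul_left C).subtype _
  · exact fun ω w hw => (hU w hw).1 ω.1

end dominated

/-- In the Möbius coordinate the point is moved slightly outward from `u`, close enough to remain in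
the region of summability. Its coordinates must be nonzero so that the turning weight `(1 - s²) z' /
(1 - s z')` can serve as a bound. -/
theorem exists_dominating {s : ℂ} (hs₁ : s ^ 2 ≠ 1) {f : Sign N → ℝ} {u : Fin N → ℂ}
    (hu : u ∈ regular s (Fin N)) (hsum : ∀ᶠ z in 𝓝 u, Summable fun ω => ‖pathWeight s f z ω‖) :
    ∃ z' ∈ regular s (Fin N), (∀ j, z' j ≠ 0) ∧ (Summable fun ω => ‖pathWeight s f z' ω‖) ∧
      u ∈ mobDisc s z' := by
  let w : Fin N → ℝ → ℂ := fun j c =>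
    if mob s (u j) = 0 then (c : ℂ) else (1 + c) * mob s (u j)
  have hw0 : ∀ j, w j 0 = mob s (u j) := fun j => by
    simp only [w]
    split_ifs with h <;> simp [h]
  have hwc : ∀ j, Continuous (w j) := fun j => by
    simp only [w]
    split_ifs <;> fun_prop
  have hwn : ∀ j, ∀ c > 0, ‖mob s (u j)‖ < ‖w j c‖ := fun j c hc => by
    simp only [w]
    split_ifs with h
    · rw [h, norm_zero, Complex.norm_real, Real.norm_eq_abs, abs_of_pos hc]
      exact hc
    · have h1 : ‖(1 + c : ℂ)‖ = 1 + c := by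
        rw [← Complex.ofReal_one, ← Complex.ofReal_add, Complex.norm_real, Real.norm_eq_abs,
          abs_of_pos (by linarith)]
      rw [norm_mul, h1]
      have := norm_pos_iff.2 h
      nlinarith
  have hden : ∀ j, 1 + s * w j 0 ≠ 0 := fun j => by
    have h1 := hu j
    have h2 : 1 + s * w j 0 = (1 - s ^ 2) / (1 - s * u j) := by
      rw [hw0, mob]
      field_simp
      ring
    rw [h2]
    exact div_ne_zero (sub_ne_zero.2 hs₁.symm) h1
  have hmob : ∀ v, 1 + s * v ≠ 0 → 1 - s * ((v + s) / (1 + s * v)) = (1 - s ^ 2) / (1 + s * v) ∧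
      mob s ((v + s) / (1 + s * v)) = v := fun v hv => by
    have h1 : 1 - s * ((v + s) / (1 + s * v)) = (1 - s ^ 2) / (1 + s * v) := by
      field_simp
      ring
    refine ⟨h1, ?_⟩
    have h2 : 1 - s ^ 2 ≠ 0 := sub_ne_zero.2 hs₁.symm
    rw [mob, h1, div_eq_iff (div_ne_zero h2 hv)]
    linear_combination s * mul_inv_cancel₀ hv
  -- The inverse Möbius map applied to the enlarged images.
  let γ : ℝ → Fin N → ℂ := fun c j => (w j c + s) / (1 + s * w j c)
  have hγc : ContinuousAt γ 0 := continuousAt_pi.2 fun j =>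
    ContinuousAt.div ((hwc j).continuousAt.add continuousAt_const)
      (continuousAt_const.add (continuousAt_const.mul (hwc j).continuousAt)) (hden j)
  have hγ0 : γ 0 = u := funext fun j => by
    have h1 := hu j
    have h2 : 1 + s * mob s (u j) = (1 - s ^ 2) / (1 - s * u j) := by
      rw [mob]
      field_simp
      ring
    have h3 : 1 - s ^ 2 ≠ 0 := sub_ne_zero.2 hs₁.symm
    simp only [γ, hw0, h2]
    rw [mob, div_eq_iff (div_ne_zero h3 h1)]
    linear_combination (-s) * mul_inv_cancel₀ h1
  have hγ : Tendsto γ (𝓝[>] 0) (𝓝 u) := by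
    rw [ContinuousAt, hγ0] at hγc
    exact hγc.mono_left nhdsWithin_le_nhds
  have e1 : ∀ j, ∀ᶠ c in 𝓝[>] (0 : ℝ), 1 + s * w j c ≠ 0 := fun j =>
    ((continuous_const.add (continuous_const.mul (hwc j))).continuousAt.eventually_ne
      (hden j)).filter_mono nhdsWithin_le_nhds
  -- The image `-s` corresponds to the coordinate `0`. If `u j = 0`, enlarging the modulus already
  -- moves the image away from `-s`.
  have e2 : ∀ j, ∀ᶠ c in 𝓝[>] (0 : ℝ), w j c ≠ -s := fun j => by
    by_cases h : w j 0 = -s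
    · filter_upwards [self_mem_nhdsWithin] with c hc h1
      have := hwn j c hc
      rw [h1, ← h, hw0] at this
      exact lt_irrefl _ this
    · exact ((hwc j).continuousAt.eventually_ne h).filter_mono nhdsWithin_le_nhds
  obtain ⟨c, hc, hsc, h1, h2⟩ := ((eventually_mem_nhdsWithin (s := Set.Ioi (0 : ℝ)) (a := 0)).and
    ((hγ.eventually hsum).and ((eventually_all.2 e1).and (eventually_all.2 e2)))).exists
  refine ⟨γ c, fun j => ?_, fun j => ?_, hsc, hu, fun j => ?_⟩
  · rw [(hmob _ (h1 j)).1]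
    exact div_ne_zero (sub_ne_zero.2 hs₁.symm) (h1 j)
  · exact div_ne_zero (fun h => h2 j (eq_neg_of_add_eq_zero_left h)) (h1 j)
  · rw [(hmob _ (h1 j)).2]
    exact hwn j c hc

/-! ### Action of `D_m^r` on constrained partition functions. -/

theorem replicate_prefix_ofFn {r n : ℕ} (v : ℕ → Bool) (hv : ∀ x ≥ n, v x = false) :
    List.replicate r true <+: List.ofFn (fun x : Fin n => v x) ↔ ∀ x < r, v x = true := by
  rw [List.prefix_iff_getElem?]
  simp only [List.length_replicate, List.getElem_replicate, List.getElem?_ofFn]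
  refine forall₂_congr fun x hx => ?_
  by_cases h : x < n
  · simp [h]
  · simp [h, hv x (not_lt.1 h)]

theorem PathConfig.sig_eq_of_top {ω ω' : PathConfig N}
    (h : (fun x => ω.vert x (Fin.last N)) = fun x => ω'.vert x (Fin.last N)) :
    ω.sig N le_rfl = ω'.sig N le_rfl := by
  have h1 : (ω.level_finite N le_rfl).toFinset = (ω'.level_finite N le_rfl).toFinset := by
    ext x
    simp only [Set.Finite.mem_toFinset]
    exact Eq.to_iff (congrArg (· = true) (congrFun h x))
  have h2 : ∀ (S T : Finset ℕ) (hS : S.card = N) (hT : T.card = N), S = T →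
      (fun i : Fin N => S.orderEmbOfFin hS i.rev) = fun i => T.orderEmbOfFin hT i.rev := by
    rintro S _ hS hT rfl
    rfl
  exact Subtype.ext (h2 _ _ _ _ h1)

/-- The constraints `K` in terms of occupation numbers. -/
def prefixOk (K : Set (ℕ × ℕ)) (y : ℕ) (t : List Bool) : Prop :=
  ∀ r, (y, r) ∈ K → List.replicate r true <+: t

/-- Extension of a tuple by zeros. -/
def extendZero (z : Fin N → ℂ) (y : ℕ) : ℂ := if h : y < N then z ⟨y, h⟩ else 0

theorem extendZero_val (z : Fin N → ℂ) (y : Fin N) : extendZero z y = z y := by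
  simp [extendZero]

/-- The contribution to `constrSum` of the configurations with top level `v`. -/
def topSum (s : ℂ) (f : Sign N → ℝ) (K : Set (ℕ × ℕ)) (v : ℕ → Bool) (z : Fin N → ℂ) : ℂ :=
  ∑' ω : (fun (ω : PathConfig N) x => ω.vert x (Fin.last N)) ⁻¹' {v},
    (constrained N K).indicator (pathWeight s f z) ω

theorem hasSum_topSum {s : ℂ} {f : Sign N → ℝ} {z : Fin N → ℂ}
    (hsum : Summable fun ω => pathWeight s f z ω) (K : Set (ℕ × ℕ)) :
    HasSum (fun v => topSum s f K v z) (constrSum s f K z) := by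
  rw [constrSum, tsum_subtype (constrained N K) (pathWeight s f z)]
  exact (hsum.indicator _).hasSum.tsum_fiberwise _

theorem topSum_eq_zero (s : ℂ) (f : Sign N → ℝ) (K : Set (ℕ × ℕ)) {v : ℕ → Bool} (z : Fin N → ℂ)
    (h : ∀ ω : PathConfig N, (fun x => ω.vert x (Fin.last N)) ≠ v) : topSum s f K v z = 0 := by
  rw [topSum]
  have : ∀ ω : (fun (ω : PathConfig N) x => ω.vert x (Fin.last N)) ⁻¹' {v},
      (constrained N K).indicator (pathWeight s f z) ω = 0 := fun ω => absurd ω.2 (h ω.1)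
  simp only [this, tsum_zero]

theorem topSum_eq_resRows (s : ℂ) (f : Sign N → ℝ) (K : Set (ℕ × ℕ)) (z : Fin N → ℂ)
    (ω₀ : PathConfig N) {n : ℕ} (hn : ∀ x ≥ n, ω₀.vert x (Fin.last N) = false) :
    topSum s f K (fun x => ω₀.vert x (Fin.last N)) z =
      resRows s (prefixOk K) (extendZero z) N (List.ofFn fun x : Fin n => ω₀.vert x (Fin.last N)) *
        (f (ω₀.sig N le_rfl) : ℂ) := by
  classical
  rw [← PathConfig.tsum_top s (prefixOk K) (extendZero z) (fun x => ω₀.vert x (Fin.last N)) hn,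
    ← tsum_mul_right]
  refine tsum_congr fun ω => ?_
  have hω : (fun x => ω.1.vert x (Fin.last N)) = fun x => ω₀.vert x (Fin.last N) := ω.2
  have htop : ∀ x ≥ n, ω.1.vert x (Fin.last N) = false := fun x hx =>
    (congrFun hω x).trans (hn x hx)
  have hiff : (∀ y : Fin (N + 1), prefixOk K y (List.ofFn fun x : Fin n => ω.1.vert x y)) ↔
      ω.1 ∈ constrained N K := by
    refine forall_congr' fun y => forall₂_congr fun r _ => ?_
    exact replicate_prefix_ofFn (fun x => ω.1.vert x y) (ω.1.vert_eq_false htop y)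
  rw [Set.indicator_apply]
  simp only [hiff, extendZero_val]
  split_ifs with h
  · rw [pathWeight_eq, PathConfig.sig_eq_of_top hω]
  · simp

/-- The tuple with first entries `w` and the remaining entries as in `z`. -/
def glue {m : ℕ} (w : Fin m → ℂ) (z : Fin N → ℂ) : Fin N → ℂ :=
  fun j => if h : (j : ℕ) < m then w ⟨j, h⟩ else z j

/-- With the top level fixed, `f` is a constant factor and only finitely many columns matter. No
constraint lies below level `m`, so the state there is an unrestricted Bethe function and the
eigenrelation applies; constraints of `K` at level `m` are a cutoff in `t` that commutes with the
operator. -/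
theorem sum_coeffD_mul_topSum {s : ℂ} (hs : s ≠ 0) (hs₁ : s ^ 2 ≠ 1) (f : Sign N → ℝ)
    {K : Set (ℕ × ℕ)} {m : ℕ} (r : ℕ) (hm : m ≤ N) (hK : ∀ c ∈ K, m ≤ c.1) {w : Fin m → ℂ}
    (hw : w ∈ regular s (Fin m)) (hwi : Function.Injective w) (z : Fin N → ℂ) (v : ℕ → Bool) :
    ∑ I ∈ Finset.powersetCard r Finset.univ,
      coeffD s r w I * topSum s f K v (glue (substS s I w) z) =
    topSum s f (insert (m, r) K) v (glue w z) := by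
  classical
  by_cases h : ∃ ω : PathConfig N, (fun x => ω.vert x (Fin.last N)) = v
  · obtain ⟨ω₀, rfl⟩ := h
    obtain ⟨n, hn, -⟩ := ω₀.exists_bound N le_rfl
    simp only [topSum_eq_resRows s f _ _ ω₀ hn, ← mul_assoc, ← Finset.sum_mul]
    congr 1
    have hres : ∀ w : Fin m → ℂ, (fun i : Fin m => extendZero (glue w z) i) = w := fun w => by
      funext i
      simp [extendZero, glue, i.2.trans_le hm]
    refine sum_mul_resRows _ _ _ _ (m := m) ?_ ?_ ?_ hm _
    · intro I _ y hy
      have hy' : ¬ y < m := not_lt.2 hy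
      simp [extendZero, glue, hy']
    · intro y hy
      funext t
      simp [prefixOk, hy.ne']
    · intro t
      have h1 : ∀ y < m, ∀ t, prefixOk K y t := fun y hy t r hr =>
        absurd (hK _ hr) (not_le.2 hy)
      have h2 : ∀ y < m, ∀ t, prefixOk (insert (m, r) K) y t := fun y hy t r' hr => by
        rcases hr with hr | hr
        · exact absurd (congrArg Prod.fst hr) hy.ne
        · exact h1 y hy t r' hr
      rw [resRows_eq_betheExt hs h2 (by rwa [hres]), hres]
      have h3 : ∀ I : Finset (Fin m), resRows s (prefixOk K) (extendZero (glue (substS s I w) z)) m t =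
          if prefixOk K m t then betheExt s t Finset.univ (substS s I w) else 0 := fun I => by
        rw [resRows_eq_betheExt hs h1 (by rw [hres]; exact substS_mem_regular hs₁ I hw), hres]
      simp only [h3]
      have h4 : prefixOk (insert (m, r) K) m t ↔ prefixOk K m t ∧ List.replicate r true <+: t := by
        simp only [prefixOk, Set.mem_insert_iff, Prod.mk.injEq, true_and]
        constructor
        · exact fun h => ⟨fun r' hr' => h r' (Or.inr hr'), h r (Or.inl rfl)⟩
        · rintro ⟨h, h'⟩ r' (rfl | hr')
          · exact h'
          · exact h r' hr'
      by_cases h5 : prefixOk K m t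
      · simp only [h5, if_true, sum_coeffD_mul_betheExt hs hs₁ r hw hwi, h4, true_and]
      · simp [h5, h4]
  · push Not at h
    simp [topSum_eq_zero s f _ _ h]

section operator
variable {s : ℂ} {f : Sign N → ℝ} {z' : Fin N → ℂ}

/-- Substituting `s` sends a coordinate to the centre of its Möbius disc, because `mob s s = 0`. -/
theorem glue_substS_mem_mobDisc (hs₁ : s ^ 2 ≠ 1) {m : ℕ} {w : Fin m → ℂ} {z : Fin N → ℂ}
    (hw : glue w z ∈ mobDisc s z') (I : Finset (Fin m)) : glue (substS s I w) z ∈ mobDisc s z' := by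
  have hself : mob s s = 0 := by simp [mob]
  have key : ∀ j, glue (substS s I w) z j = s ∨ glue (substS s I w) z j = glue w z j := fun j => by
    by_cases h : (j : ℕ) < m
    · by_cases h' : (⟨j, h⟩ : Fin m) ∈ I <;> simp [glue, substS, h, h']
    · simp [glue, h]
  refine ⟨fun j => ?_, fun j => ?_⟩
  · rcases key j with h | h <;> rw [h]
    · exact const_mem_regular hs₁ (Fin N) j
    · exact hw.1 j
  · rcases key j with h | h <;> rw [h]
    · rw [hself, norm_zero]
      exact (norm_nonneg _).trans_lt (hw.2 j)
    · exact hw.2 j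

/-- The operator `D_m^r` imposes that the first `r` columns are occupied at level `m`. -/
theorem opDFirst_eq_constrSum (hs : s ≠ 0) (hs₁ : s ^ 2 ≠ 1) (hz' : z' ∈ regular s (Fin N))
    (h0 : ∀ j, z' j ≠ 0) (hsum : Summable fun ω => ‖pathWeight s f z' ω‖) {K : Set (ℕ × ℕ)} {m : ℕ}
    (r : ℕ) (hm : m ≤ N) (hK : ∀ c ∈ K, m ≤ c.1) {G : (Fin N → ℂ) → ℂ}
    (hG : ∀ z ∈ mobDisc s z', G z = constrSum s f K z) {z : Fin N → ℂ} (hz : z ∈ mobDisc s z') :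
    opDFirst s m r hm G z = constrSum s f (insert (m, r) K) z := by
  have hglue : glue (fun i => z (Fin.castLE hm i)) z = z := by
    funext j
    simp only [glue]
    split_ifs <;> rfl
  have hcont : Continuous fun w : Fin m → ℂ => glue w z := by
    refine continuous_pi fun j => ?_
    simp only [glue]
    split_ifs <;> fun_prop
  have hcz : Tendsto (fun w : Fin m → ℂ => glue w z) (𝓝 fun i => z (Fin.castLE hm i)) (𝓝 z) := by
    have := hcont.tendsto fun i => z (Fin.castLE hm i)
    rwa [hglue] at this
  have hf : ContinuousAt (fun w : Fin m → ℂ => constrSum s f (insert (m, r) K) (glue w z))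
      fun i => z (Fin.castLE hm i) := by
    have h1 := continuousAt_constrSum hs hs₁ hz' h0 hsum (insert (m, r) K) hz
    rw [← hglue] at h1
    exact ContinuousAt.comp (f := fun w : Fin m → ℂ => glue w z) h1 hcont.continuousAt
  have key : opDFirst s m r hm G z = opD s m r (fun w => G (glue w z))
      fun i => z (Fin.castLE hm i) := rfl
  rw [key, opD_eq, extendDiag_eq hf, hglue]
  filter_upwards [mem_nhdsWithin_of_mem_nhds (hcz ((isOpen_mobDisc s z').mem_nhds hz)),
    self_mem_nhdsWithin] with w h1 hwi
  have h1 : glue w z ∈ mobDisc s z' := h1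
  have hw : w ∈ regular s (Fin m) := fun i => by
    have := h1.1 (Fin.castLE hm i)
    simpa [glue] using this
  have h2 : ∀ I, HasSum (fun v => topSum s f K v (glue (substS s I w) z))
      (G (glue (substS s I w) z)) := fun I => by
    have h3 := glue_substS_mem_mobDisc hs₁ h1 I
    rw [hG _ h3]
    exact hasSum_topSum (summable_pathWeight hs hs₁ hz' h0 hsum h3) K
  -- The identity holds for each top level separately; absolute convergence at every substituted
  -- point permits summing over top levels.
  have h4 := hasSum_sum (s := Finset.powersetCard r Finset.univ) fun I _ =>
    (h2 I).mul_left (coeffD s r w I)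
  simp only [sum_coeffD_mul_topSum hs hs₁ f r hm hK hw hwi z] at h4
  exact h4.unique (hasSum_topSum (summable_pathWeight hs hs₁ hz' h0 hsum h1) _)

theorem foldr_opDFirst (hs : s ≠ 0) (hs₁ : s ^ 2 ≠ 1) (hz' : z' ∈ regular s (Fin N))
    (h0 : ∀ j, z' j ≠ 0) (hsum : Summable fun ω => ‖pathWeight s f z' ω‖) {k : ℕ} (m r : Fin k → ℕ)
    (hm : ∀ i, m i ≤ N) (hmono : Monotone m) {z : Fin N → ℂ} (hz : z ∈ mobDisc s z') :
    Fin.foldr k (fun i H => opDFirst s (m i) (r i) (hm i) H) (partitionFn s f) z =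
      constrSum s f (Set.range fun i => (m i, r i)) z := by
  induction k generalizing z with
  | zero =>
    rw [Fin.foldr_zero, partitionFn, constrSum]
    have : constrained N (Set.range fun i : Fin 0 => (m i, r i)) = Set.univ := by
      ext ω
      simp [constrained]
    rw [this]
    exact (tsum_univ fun ω => pathWeight s f z ω).symm
  | succ k ih =>
    rw [Fin.foldr_succ]
    have h1 : (Set.range fun i => (m i, r i)) =
        insert (m 0, r 0) (Set.range fun i : Fin k => (m i.succ, r i.succ)) := by
      ext c
      simp [Fin.exists_fin_succ, eq_comm]
    rw [h1]
    refine opDFirst_eq_constrSum hs hs₁ hz' h0 hsum (r 0) (hm 0) ?_ ?_ hz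
    · rintro _ ⟨i, rfl⟩
      exact hmono (Fin.zero_le _)
    · intro z hz
      exact ih (fun i => m i.succ) (fun i => r i.succ) (fun i => hm i.succ)
        (fun i j hij => hmono (Fin.succ_le_succ_iff.2 hij)) hz

end operator

/-! ### The event and the probability measure. -/

theorem PathConfig.sig_mem_signStarZero (ω : PathConfig N) {m : ℕ} (hm : m ≤ N) (r : ℕ) :
    ω.sig m hm ∈ SignStarZero m r ↔
      ∀ x < r, ω.vert x ⟨m, Nat.lt_succ_of_le hm⟩ = true := by
  set S := (ω.level_finite m hm).toFinset with hS
  set e := S.orderEmbOfFin (ω.card_level m hm) with he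
  have hmem : ∀ x, x ∈ S ↔ ω.vert x ⟨m, Nat.lt_succ_of_le hm⟩ = true := fun x => by
    rw [hS, Set.Finite.mem_toFinset]
    rfl
  have hsig : ∀ i, (ω.sig m hm).1 i = e i.rev := fun i => rfl
  constructor
  · rintro ⟨-, h⟩ x hx
    obtain ⟨i, -, hi⟩ := h x hx
    rw [← hmem, ← hi, hsig]
    exact Finset.orderEmbOfFin_mem _ _ _
  · intro h
    refine ⟨fun i j hij => e.strictMono (Fin.rev_lt_rev.2 hij), ?_⟩
    -- A strictly increasing enumeration satisfies `i ≤ e i`; since all `x < r` are attained, it has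
    -- to begin `0, 1, …, r - 1`.
    have hle : ∀ i : Fin m, (i : ℕ) ≤ e i := by
      rintro ⟨i, hi⟩
      induction i with
      | zero => exact Nat.zero_le _
      | succ i ih =>
        have h1 := ih (by omega)
        have h2 : e ⟨i, by omega⟩ < e ⟨i + 1, hi⟩ := e.strictMono (Nat.lt_succ_self i)
        simp only at h1 ⊢
        omega
    have hex : ∀ x < r, ∃ i : Fin m, e i = x := fun x hx => by
      have : x ∈ Set.range e := by
        rw [he, Finset.range_orderEmbOfFin]
        exact (hmem x).2 (h x hx)
      exact this
    have hfix : ∀ x < r, ∃ i : Fin m, (i : ℕ) = x ∧ e i = x := by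
      intro x
      induction x with
      | zero =>
        intro hx
        obtain ⟨i, hi⟩ := hex 0 hx
        exact ⟨i, Nat.le_zero.1 (hi ▸ hle i), hi⟩
      | succ x ih =>
        intro hx
        obtain ⟨j, hj, hj'⟩ := ih (by omega)
        obtain ⟨i, hi⟩ := hex _ hx
        refine ⟨i, le_antisymm (hi ▸ hle i) ?_, hi⟩
        have : j < i := e.lt_iff_lt.1 (by rw [hi, hj']; exact Nat.lt_succ_self x)
        have h3 : (j : ℕ) < i := this
        omega
    intro x hx
    obtain ⟨i, hi, hi'⟩ := hfix x hx
    refine ⟨i.rev, ?_, by rw [hsig, Fin.rev_rev, hi']⟩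
    rw [Fin.val_rev]
    have := i.2
    omega

theorem eventA_eq_constrained {k : ℕ} (m : Fin k → ℕ) (hm : ∀ i, m i ≤ N) :
    eventA m hm = constrained N (Set.range fun i : Fin k => (m i, (i : ℕ) + 1)) := by
  ext ω
  simp only [eventA, Set.mem_ofPred_eq, PathConfig.sig_mem_signStarZero, constrained, Set.mem_range,
    Prod.mk.injEq]
  constructor
  · rintro h y r ⟨i, hi, rfl⟩ x hx
    have := h i x hx
    convert this
    exact hi.symm
  · intro h i x hx
    exact h ⟨m i, Nat.lt_succ_of_le (hm i)⟩ _ ⟨i, rfl, rfl⟩ x hx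

theorem sixVertexMeasure_apply {s : ℂ} {f : Sign N → ℝ} {u : Fin N → ℂ} (A : Set (PathConfig N)) :
    sixVertexMeasure s f u A = ∑' ω, ENNReal.ofReal
      (A.indicator (fun ω => (pathWeight s f u ω / partitionFn s f u).re) ω) := by
  classical
  rw [sixVertexMeasure, Measure.sum_apply _ MeasurableSpace.measurableSet_top]
  refine tsum_congr fun ω => ?_
  rw [Measure.smul_apply, Measure.dirac_apply' _ MeasurableSpace.measurableSet_top]
  by_cases h : ω ∈ A <;> simp [h]

theorem sixVertexMeasure_eq_ofReal {s : ℂ} {f : Sign N → ℝ} {u : Fin N → ℂ}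
    (hsum : Summable fun ω => pathWeight s f u ω) (hnonneg : ∀ ω, 0 ≤ pathWeight s f u ω)
    (hpos : 0 < partitionFn s f u) (A : Set (PathConfig N)) :
    ∃ p : ℝ, 0 ≤ p ∧ sixVertexMeasure s f u A = ENNReal.ofReal p ∧
      (p : ℂ) = (∑' ω : A, pathWeight s f u ω) / partitionFn s f u := by
  have hq : ∀ ω, 0 ≤ pathWeight s f u ω / partitionFn s f u := fun ω =>
    div_nonneg (hnonneg ω) hpos.le
  have hre : ∀ ω, ((pathWeight s f u ω / partitionFn s f u).re : ℂ) =
      pathWeight s f u ω / partitionFn s f u := fun ω =>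
    (Complex.eq_re_of_ofReal_le (r := 0) (by simpa using hq ω)).symm
  have hnn : ∀ ω, 0 ≤ A.indicator (fun ω => (pathWeight s f u ω / partitionFn s f u).re) ω :=
    fun ω => Set.indicator_nonneg (fun ω _ => (Complex.nonneg_iff.1 (hq ω)).1) ω
  have hs : Summable fun ω => (pathWeight s f u ω / partitionFn s f u).re :=
    (Complex.hasSum_re (hsum.div_const _).hasSum).summable
  refine ⟨∑' ω, A.indicator (fun ω => (pathWeight s f u ω / partitionFn s f u).re) ω,
    tsum_nonneg hnn, ?_, ?_⟩
  · rw [sixVertexMeasure_apply, ENNReal.ofReal_tsum_of_nonneg hnn (hs.indicator A)]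
  · rw [Complex.ofReal_tsum, tsum_subtype A (pathWeight s f u), ← tsum_div_const]
    refine tsum_congr fun ω => ?_
    by_cases h : ω ∈ A
    · rw [Set.indicator_of_mem h, Set.indicator_of_mem h, hre]
    · rw [Set.indicator_of_notMem h, Set.indicator_of_notMem h, zero_div, Complex.ofReal_zero]

end SixVertex
end

open SixVertex

theorem lemma3p6 (N : ℕ) (s : ℂ) (hs₀ : s ≠ 0) (hs₁ : s ^ 2 ≠ 1)
    (u : Fin N → ℂ) (hu : Function.Injective u) (hu_pole : ∀ j, 1 - s * u j ≠ 0)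
    (f : SixVertex.Sign N → ℝ) (hf : ∀ l, f l ≠ 0 → l ∈ SixVertex.SignStar N)
    (hsum : ∀ᶠ z in 𝓝 u, Summable fun ω => ‖SixVertex.pathWeight s f z ω‖)
    (hnonneg : ∀ ω, 0 ≤ SixVertex.pathWeight s f u ω)
    (hpos : 0 < SixVertex.partitionFn s f u)
    (k : ℕ) (m : Fin k → ℕ) (hmono : Monotone m) (hm₁ : ∀ i, 1 ≤ m i) (hmN : ∀ i, m i ≤ N) :
    IsProbabilityMeasure (SixVertex.sixVertexMeasure s f u) ∧
    (((SixVertex.sixVertexMeasure s f u).real (SixVertex.eventA m hmN) : ℝ) : ℂ) =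
      SixVertex.eventWeight s f m hmN u / SixVertex.partitionFn s f u ∧
    SixVertex.eventWeight s f m hmN u / SixVertex.partitionFn s f u =
      SixVertex.opDProd s m hmN (SixVertex.partitionFn s f) u / SixVertex.partitionFn s f u := by
  have hsu : Summable fun ω => pathWeight s f u ω := hsum.self_of_nhds.of_norm
  refine ⟨⟨?_⟩, ?_, ?_⟩
  · obtain ⟨p, -, hp, hp'⟩ := sixVertexMeasure_eq_ofReal hsu hnonneg hpos Set.univ
    rw [tsum_univ fun ω => pathWeight s f u ω, ← partitionFn, div_self hpos.ne'] at hp'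
    rw [hp, Complex.ofReal_eq_one.1 hp', ENNReal.ofReal_one]
  · obtain ⟨p, hp0, hp, hp'⟩ := sixVertexMeasure_eq_ofReal hsu hnonneg hpos (eventA m hmN)
    rw [Measure.real, hp, ENNReal.toReal_ofReal hp0, hp', eventWeight]
  · obtain ⟨z', hz', h0, hz'sum, huz'⟩ := exists_dominating hs₁ hu_pole hsum
    rw [opDProd, foldr_opDFirst hs₀ hs₁ hz' h0 hz'sum m (fun i => (i : ℕ) + 1) hmN hmono huz',
      constrSum, ← eventA_eq_constrained m hmN, eventWeight]
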